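/- Let $L=\{+,\dotminus,\le,0,1,\tau\}$ and let $PresTOAG$ be the $L$-theory of Presburger truncated ordered abelian groups. It consists of the following axioms. (a) $\le$ is a linear order with least element $0$ and greatest element $\tau$; $+$ is commutative, associative and monotone in both arguments, with $x+0=x$ and $x+\tau=\tau$; if $x+y=x+z<\tau$ then $y=z$; if $x\le y<\tau$ then there is a unique $z$ with $x+z=y$, and $y\dotminus x$ is this $z$; $y\dotminus x=0$ if $y\le x$; if $x>0$ then $x+z=\tau$ for some $z<\tau$; $\tau\dotminus x=\min\{z: x+z=\tau\}$ and $\tau\dotminus(\tau\dotminus x)=x$; and the carry axioms: - if $x,y<\tau$ and $x+y=\tau$ then $y\dotminus(\tau\dotminus x)=x\dotminus(\tau\dotminus y)$; - if $y+z<\tau$, $x+(y+z)=\tau$ and $y+x<\tau$ then $x\dotminus(\tau\dotminus(y+z))=z\dotminus(\tau\dotminus(x+y))$; - if $y+z<\tau$, $x+(y+z)=\tau$, $x+y=\tau$ and $z+(y\dotminus(\tau\dotminus x))<\tau$ then $x\dotminus(\tau\dotminus(y+z))=z+(y\dotminus(\tau\dotminus x))$; - if $y+x=\tau$ and $y+z<\tau$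 then $z+(y\dotminus(\tau\dotminus x))<\tau$; - if $y+z=y+x=\tau$ and $z+(y\dotminus(\tau\dotminus x))<\tau$ then $x+(y\dotminus(\tau\dotminus z))=(x\dotminus(\tau\dotminus y))+z$; - if $y+z=y+x=\tau$ and $x+(y\dotminus(\tau\dotminus z))=\tau$ then $z+(y\dotminus(\tau\dotminus x))=\tau$; - if $y+z=y+x=x+(y\dotminus(\tau\dotminus z))=\tau$ then $(y\dotminus(\tau\dotminus x))\dotminus(\tau\dotminus z)=(y\dotminus(\tau\dotminus z))\dotminus(\tau\dotminus x)$. (b) $1$ is the least positive element, every element $<\tau$ has an immediate successor, and every positive element is an immediate successor. (c) For every $n\ge1$ and every $x$ there are $y$ and an integer $0\le m<n$ with $x=ny+m1$. Here $ny$ is $y+\dots+y$ ($n$ times). Say that $n\ge 1$ divides $d$ if $z\le d$ and $d\dotminus z=(n-1)z$ for some $z$ (that is, $d=nz$ without truncation), and write $x\equiv_n y$ if $n$ divides $(x\dotminus y)+(y\dotminus x)$. For integers $0\le m<q$, "$\tau\equiv m\pmod q$" is the sentence saying that $m1$ is not truncated (that is, $m=0$ or $(m-1)1<\tau$) and that $q$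 divides $\tau\dotminus m1$. For $f=(f(p))_p\in\hat{\mathbb Z}=\prod_p\mathbb Z_p$ let $C_f$ be the set of all sentences $\tau\equiv m\pmod{p^k}$, where $p$ is a prime, $k\ge1$, and $0\le m<p^k$ is the residue of $f(p)$ modulo $p^k$. A completion of $PresTOAG$ is a complete, deductively closed $L$-theory that contains $PresTOAG$. Then: 1. $PresTOAG$ is model complete: every embedding between two of its models is elementary. 2. $PresTOAG$ is consistent and not complete. For every $f\in\hat{\mathbb Z}$ the theory $PresTOAG\cup C_f$ together with the axioms saying that the universe is infinite is complete, and mapping $f$ to the set of consequences of this theory is a bijection from $\hat{\mathbb Z}$ onto the set of completions of $PresTOAG$ that have infinite models. If $f$ is not (the image of) a positive integer, then already $PresTOAG\cup C_f$ is complete. The other completions are the following: for each integer $n\ge1$ the theory $PresTOAG\cup\{(n-1)1<\tau,\ n1=\tau\}$ (that is, "$\tau=n$") is complete, and mapping $n$ to its set of consequences is a bijection from the positive integers onto the set of completions of $PresTOAG$ that have no infinite model. 3. In the language $L$ augmented by binary relation symbols $\equiv_n$, $n\ge2$, the theory $PresTOAG$ together with the above definitions of the $\equiv_n$ has quantifier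 elimination: every formula is equivalent, modulo the theory, to a quantifier-free formula in the same free variables. -/

import Mathlib

open FirstOrder FirstOrder.Language

universe u v

namespace TOAG

/-- Function symbols of the language of truncated ordered abelian groups with a constant for the
least positive element: constants `0`, `1`, `τ`, binary `+` and `∸`. -/
inductive ToagFunc : ℕ → Type
  | zero : ToagFunc 0
  | one : ToagFunc 0
  | tau : ToagFunc 0
  | add : ToagFunc 2
  | monus : ToagFunc 2

/-- The only relation symbol is the binary `≤`. -/
inductive ToagRel : ℕ → Type
  | le : ToagRel 2

/-- The first-order language `{+, ∸, ≤, 0, 1, τ}`. -/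
def toag : FirstOrder.Language.{0, 0} where
  Functions := ToagFunc
  Relations := ToagRel

instance : toag.IsOrdered := ⟨ToagRel.le⟩

section Terms

variable {α : Type*}

instance : Zero (toag.Term α) := ⟨Constants.term (L := toag) ToagFunc.zero⟩
instance : One (toag.Term α) := ⟨Constants.term (L := toag) ToagFunc.one⟩
instance : Add (toag.Term α) := ⟨Functions.apply₂ (L := toag) ToagFunc.add⟩

/-- The constant `τ` (the top element). -/
def tau : toag.Term α := Constants.term (L := toag) ToagFunc.tau

/-- The term `s ∸ t`. -/
def monus (s t : toag.Term α) : toag.Term α := Functions.apply₂ (L := toag) ToagFunc.monus s t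

/-- The term `t + ⋯ + t` (`n` summands). -/
def mult : ℕ → toag.Term α → toag.Term α
  | 0, _ => 0
  | n + 1, t => mult n t + t

end Terms

infixl:66 " ∸ " => monus

/-- Terms in the variables `x_0, …, x_{k-1}`. -/
abbrev Tm (k : ℕ) : Type := toag.Term (Empty ⊕ Fin k)

/-- The variable `x_i`. -/
abbrev x {k : ℕ} (i : Fin k) : Tm k := Term.var (Sum.inr i)

/-- The formula `s ≤ t`. -/
abbrev leF {k : ℕ} (s t : Tm k) : toag.BoundedFormula Empty k := Term.le s t

/-- The formula `s < t`. -/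
abbrev ltF {k : ℕ} (s t : Tm k) : toag.BoundedFormula Empty k := Term.lt s t

/-- The formula `s = t`. -/
abbrev eqF {k : ℕ} (s t : Tm k) : toag.BoundedFormula Empty k := Term.bdEqual s t

infix:88 " ≼ " => leF
infix:88 " ≺ " => ltF
infix:88 " ≐ " => eqF

/-! ### Axioms for truncated ordered abelian groups -/

/-- `0` is the least and `τ` the greatest element. -/
def axBounds : toag.Sentence := ∀' (0 ≼ x 0 ⊓ x 0 ≼ tau)

def axAddComm : toag.Sentence := ∀' ∀' ((x 0 + x 1) ≐ (x 1 + x 0))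

def axAddZeroTau : toag.Sentence := ∀' (((x 0 + 0) ≐ x 0) ⊓ ((x 0 + tau) ≐ tau))

def axAddMono : toag.Sentence :=
  ∀' ∀' ∀' ∀' ((x 0 ≼ x 1 ⊓ x 2 ≼ x 3) ⟹ (x 0 + x 2) ≼ (x 1 + x 3))

def axAddAssoc : toag.Sentence := ∀' ∀' ∀' ((x 0 + x 1 + x 2) ≐ (x 0 + (x 1 + x 2)))

/-- If `x + y = x + z < τ` then `y = z`. -/
def axCancel : toag.Sentence :=
  ∀' ∀' ∀' ((((x 0 + x 1) ≐ (x 0 + x 2)) ⊓ (x 0 + x 1) ≺ tau) ⟹ (x 1 ≐ x 2))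

/-- If `x ≤ y < τ` then there is a unique `z` with `x + z = y`. -/
def axDiff : toag.Sentence :=
  ∀' ∀' ((x 0 ≼ x 1 ⊓ x 1 ≺ tau) ⟹
    ∃' (((x 0 + x 2) ≐ x 1) ⊓ ∀' (((x 0 + x 3) ≐ x 1) ⟹ (x 3 ≐ x 2))))

/-- If `x ≤ y < τ` then `y ∸ x` is the element `z` with `x + z = y`. -/
def axMonusDiff : toag.Sentence :=
  ∀' ∀' ((x 0 ≼ x 1 ⊓ x 1 ≺ tau) ⟹ ((x 0 + (x 1 ∸ x 0)) ≐ x 1))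

/-- If `y ≤ x` then `y ∸ x = 0`. -/
def axMonusZero : toag.Sentence :=
  ∀' ∀' (x 1 ≼ x 0 ⟹ ((x 1 ∸ x 0) ≐ 0))

/-- If `0 < x` then there is `z < τ` with `x + z = τ`. -/
def axCompl : toag.Sentence :=
  ∀' (0 ≺ x 0 ⟹ ∃' (x 1 ≺ tau ⊓ ((x 0 + x 1) ≐ tau)))

/-- `τ ∸ x` is the least `z` with `x + z = τ`. -/
def axComplMin : toag.Sentence :=
  ∀' (((x 0 + (tau ∸ x 0)) ≐ tau) ⊓ ∀' (((x 0 + x 1) ≐ tau) ⟹ (tau ∸ x 0) ≼ x 1))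

def axComplCompl : toag.Sentence := ∀' ((tau ∸ (tau ∸ x 0)) ≐ x 0)

/-! In the next axioms `x, y, z` are the variables `x 0, x 1, x 2`. -/

/-- If `x, y < τ` and `x + y = τ` then `y ∸ (τ ∸ x) = x ∸ (τ ∸ y)`. -/
def axCarryComm : toag.Sentence :=
  ∀' ∀' ((x 0 ≺ tau ⊓ x 1 ≺ tau ⊓ ((x 0 + x 1) ≐ tau)) ⟹
    ((x 1 ∸ (tau ∸ x 0)) ≐ (x 0 ∸ (tau ∸ x 1))))

/-- If `y + z < τ`, `x + (y + z) = τ` and `y + x < τ` then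
`x ∸ (τ ∸ (y + z)) = z ∸ (τ ∸ (x + y))`. -/
def axCarryAssoc₁ : toag.Sentence :=
  ∀' ∀' ∀' (((x 1 + x 2) ≺ tau ⊓ ((x 0 + (x 1 + x 2)) ≐ tau) ⊓ (x 1 + x 0) ≺ tau) ⟹
    ((x 0 ∸ (tau ∸ (x 1 + x 2))) ≐ (x 2 ∸ (tau ∸ (x 0 + x 1)))))

/-- If `y + z < τ`, `x + (y + z) = τ`, `x + y = τ` and `z + (y ∸ (τ ∸ x)) < τ` then
`x ∸ (τ ∸ (y + z)) = z + (y ∸ (τ ∸ x))`. -/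
def axCarryAssoc₂ : toag.Sentence :=
  ∀' ∀' ∀' (((x 1 + x 2) ≺ tau ⊓ ((x 0 + (x 1 + x 2)) ≐ tau) ⊓ ((x 0 + x 1) ≐ tau) ⊓
      (x 2 + (x 1 ∸ (tau ∸ x 0))) ≺ tau) ⟹
    ((x 0 ∸ (tau ∸ (x 1 + x 2))) ≐ (x 2 + (x 1 ∸ (tau ∸ x 0)))))

/-- If `y + x = τ` and `y + z < τ` then `z + (y ∸ (τ ∸ x)) < τ`. -/
def axCarryLt : toag.Sentence :=
  ∀' ∀' ∀' ((((x 1 + x 0) ≐ tau) ⊓ (x 1 + x 2) ≺ tau) ⟹ (x 2 + (x 1 ∸ (tau ∸ x 0))) ≺ tau)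

/-- If `y + z = y + x = τ` and `z + (y ∸ (τ ∸ x)) < τ` then
`x + (y ∸ (τ ∸ z)) = (x ∸ (τ ∸ y)) + z`. -/
def axCarryAssoc₃ : toag.Sentence :=
  ∀' ∀' ∀' ((((x 1 + x 2) ≐ tau) ⊓ ((x 1 + x 0) ≐ tau) ⊓ (x 2 + (x 1 ∸ (tau ∸ x 0))) ≺ tau) ⟹
    ((x 0 + (x 1 ∸ (tau ∸ x 2))) ≐ ((x 0 ∸ (tau ∸ x 1)) + x 2)))

/-- If `y + z = y + x = τ` and `x + (y ∸ (τ ∸ z)) = τ` then `z + (y ∸ (τ ∸ x)) = τ`. -/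
def axCarryTau : toag.Sentence :=
  ∀' ∀' ∀' ((((x 1 + x 2) ≐ tau) ⊓ ((x 1 + x 0) ≐ tau) ⊓ ((x 0 + (x 1 ∸ (tau ∸ x 2))) ≐ tau)) ⟹
    ((x 2 + (x 1 ∸ (tau ∸ x 0))) ≐ tau))

/-- If `y + z = y + x = x + (y ∸ (τ ∸ z)) = τ` then
`(y ∸ (τ ∸ x)) ∸ (τ ∸ z) = (y ∸ (τ ∸ z)) ∸ (τ ∸ x)`. -/
def axCarryAssoc₄ : toag.Sentence :=
  ∀' ∀' ∀' ((((x 1 + x 2) ≐ tau) ⊓ ((x 1 + x 0) ≐ tau) ⊓ ((x 0 + (x 1 ∸ (tau ∸ x 2))) ≐ tau)) ⟹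
    ((x 1 ∸ (tau ∸ x 0) ∸ (tau ∸ x 2)) ≐ (x 1 ∸ (tau ∸ x 2) ∸ (tau ∸ x 0))))

/-- The theory of truncated ordered abelian groups. -/
def toagTheory : toag.Theory :=
  toag.linearOrderTheory ∪
  {axBounds, axAddComm, axAddZeroTau, axAddMono, axAddAssoc, axCancel, axDiff, axMonusDiff,
    axMonusZero, axCompl, axComplMin, axComplCompl, axCarryComm, axCarryAssoc₁, axCarryAssoc₂,
    axCarryLt, axCarryAssoc₃, axCarryTau, axCarryAssoc₄}

/-! ### Presburger axioms -/

/-- `1` is the least positive element. -/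
def axOne : toag.Sentence :=
  (0 ≺ 1) ⊓ ∀' (0 ≺ x 0 ⟹ 1 ≼ x 0)

/-- Every element other than `τ` has an immediate successor. -/
def axHasSucc : toag.Sentence :=
  ∀' (x 0 ≺ tau ⟹ ∃' (x 0 ≺ x 1 ⊓ ∀' (x 0 ≺ x 2 ⟹ x 1 ≼ x 2)))

/-- Every positive element is an immediate successor. -/
def axIsSucc : toag.Sentence :=
  ∀' (0 ≺ x 0 ⟹ ∃' (x 1 ≺ x 0 ⊓ ∀' (x 1 ≺ x 2 ⟹ x 0 ≼ x 2)))

/-- The remainder axiom for `n`: every `x` is `n y + m 1` for some `y` and some integer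
`0 ≤ m < n`. -/
noncomputable def axRemainder (n : ℕ) : toag.Sentence :=
  ∀' ∃' (BoundedFormula.iSup fun m : Fin n => (x 0 ≐ (mult n (x 1) + mult m 1)))

/-- The theory of Presburger truncated ordered abelian groups. -/
noncomputable def presTOAG : toag.Theory :=
  toagTheory ∪ {axOne, axHasSucc, axIsSucc} ∪ {φ | ∃ n : ℕ, 1 ≤ n ∧ φ = axRemainder n}

/-! ### Congruences -/

/-- For `n ≥ 1`: `d = n z` as an untruncated sum. This is written as `d - z = (n - 1) z` with
`z ≤ d`, which cannot hold through truncation: if `(n - 1) z` is truncated to `τ`, then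
`d ∸ z = τ` forces `d = τ` and `z = 0`, hence `τ = 0`. -/
def isMultiple {k : ℕ} (n : ℕ) (d z : Tm k) : toag.BoundedFormula Empty k :=
  z ≼ d ⊓ (mult (n - 1) z ≐ (d ∸ z))

/-- For `n ≥ 1`: the elements `x 0` and `x 1` are congruent modulo `n`, that is, their
distance `(x 0 ∸ x 1) + (x 1 ∸ x 0)` (one of the two summands is `0`) is `n z` for some `z`. -/
def congruent (n : ℕ) : toag.BoundedFormula Empty 2 :=
  ∃' isMultiple n ((x 0 ∸ x 1) + (x 1 ∸ x 0)) (x 2)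

/-- For `0 ≤ m < q`: `τ ≡ m (mod q)`, that is, `τ - m = q z` for some `z`. The first conjunct says
that `m ≤ τ`, so that the term `m 1` is not truncated (it is `0 < τ` if `m = 0`). -/
def tauResidue (q m : ℕ) : toag.Sentence :=
  mult (m - 1) 1 ≺ tau ⊓ ∃' isMultiple q (tau ∸ mult m 1) (x 0)

/-- For `n ≥ 1`: `τ` is exactly `n`, that is, `(n - 1) 1 < τ` and `n 1 = τ`. -/
def tauEq (n : ℕ) : toag.Sentence :=
  mult (n - 1) 1 ≺ tau ⊓ (mult n 1 ≐ tau)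

instance (p : Nat.Primes) : Fact (p : ℕ).Prime := ⟨p.2⟩

/-- The ring of profinite integers, as the product of the rings of `p`-adic integers. -/
abbrev ZHat : Type := ∀ p : Nat.Primes, ℤ_[(p : ℕ)]

/-- The axioms `τ ≡ f(p) (mod p ^ k)` for all primes `p` and all `k ≥ 1`. -/
noncomputable def residueAxioms (f : ZHat) : toag.Theory :=
  {φ | ∃ (p : Nat.Primes) (k : ℕ), 1 ≤ k ∧
    φ = tauResidue ((p : ℕ) ^ k) (PadicInt.toZModPow k (f p)).val}

/-! ### The language with congruences -/

/-- The relation symbols `≡_n`, `n ≥ 2`, all binary. -/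
inductive CongRel : ℕ → Type
  | cong (n : ℕ) (hn : 2 ≤ n) : CongRel 2

/-- The language of truncated ordered abelian groups augmented by the relations `≡_n`, `n ≥ 2`. -/
def toagCong : FirstOrder.Language.{0, 0} := toag.sum ⟨fun _ => Empty, CongRel⟩

/-- The inclusion of languages. -/
def toagIncl : toag →ᴸ toagCong := LHom.sumInl

/-- The symbol `≡_n`. -/
def congSymb (n : ℕ) (hn : 2 ≤ n) : toagCong.Relations 2 := Sum.inr (CongRel.cong n hn)

/-- The defining axiom of `≡_n`. -/
def axCong (n : ℕ) (hn : 2 ≤ n) : toagCong.Sentence :=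
  ∀' ∀' (((congSymb n hn).boundedFormula₂ &0 &1) ⇔ toagIncl.onBoundedFormula (congruent n))

/-- The theory of Presburger truncated ordered abelian groups in the augmented language. -/
noncomputable def presTOAGCong : toagCong.Theory :=
  toagIncl.onTheory presTOAG ∪ {φ | ∃ (n : ℕ) (hn : 2 ≤ n), φ = axCong n hn}

/-! ### Model-theoretic notions -/

/-- A theory is model complete if every embedding between models is elementary. -/
def IsModelComplete {L : FirstOrder.Language.{0, 0}} (T : L.Theory) : Prop :=
  ∀ (M : Type u) (N : Type v) [L.Structure M] [L.Structure N], M ⊨ T → N ⊨ T →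
    ∀ f : M ↪[L] N, ∃ g : M ↪ₑ[L] N, ∀ x, g x = f x

/-- A theory has quantifier elimination if every formula is equivalent, modulo the theory, to a
quantifier-free one in the same free variables. -/
def HasQE {L : FirstOrder.Language.{0, 0}} (T : L.Theory) : Prop :=
  ∀ (n : ℕ) (φ : L.Formula (Fin n)), ∃ ψ : L.Formula (Fin n),
    BoundedFormula.IsQF ψ ∧ T ⊨ᵇ BoundedFormula.iff φ ψ

/-- The deductive closure of a theory. -/
def consequences {L : FirstOrder.Language.{0, 0}} (T : L.Theory) : L.Theory := {φ | T ⊨ᵇ φ}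

/-- The complete (deductively closed) extensions of a theory in the same language. -/
def completions {L : FirstOrder.Language.{0, 0}} (T : L.Theory) : Set L.Theory :=
  {T' | T ⊆ T' ∧ T'.IsMaximal}

end TOAG

/-! A model M is the interval [0, τ] of an ordered abelian group G, whose elements are the formal
sums kτ + r with k an integer and r < τ. Addition in G carries a τ whenever the rests overflow, and
the carry axioms are the identities needed for this addition to be commutative and associative; the
sign of kτ + r is the sign of k. In G the element 1 is least positive and every element has an
integer residue modulo every n (`GroupExt.isZGroup`), so G is a model of Presburger arithmetic. The
operations of M become min(a + b, τ) and max(a - b, 0), so terms of the language are piecewise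
linear in G.

All three claims rest on a quantitative back-and-forth. Two tuples are N-similar (`Sim`) if integer
linear forms of total size at most N in their entries, 1 and τ have the same signs, and the entries
have the same residues modulo every n ≤ N. By `Sim.exists_insert`, enough similarity allows any new
element of one interval to be matched by an element on the other side, in the same position and with
the same residues. Hence every formula has a depth such that tuples similar to that depth agree on
it (`realize_iff_of_sim`).

Similarity is in turn decided by finitely many quantifier-free conditions: a linear form is kτ plus
the value below τ of a term, where comparisons between terms determine k and the term
(`exists_term_of_mem_ball`), and residues are read off from the congruences x ≡ m1. This gives
quantifier elimination. Embeddings preserve term comparisons, and also residues since the witnesses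
of the remainder axioms are carried along; this gives model completeness.

For sentences there are no parameters, so the complete theory depends only on the signs of kτ + m1
and the residues of τ (`sim_of_sign`). If M is infinite, τ exceeds every integer, the signs are
lexicographic, and the residues modulo prime powers form an element of the profinite integers. If M
is finite, τ = n decides everything. Every profinite f occurs by compactness: the interval {0, …, n}
satisfies any finite part of the theory once n is large and suitably congruent to f. -/

set_option linter.unusedSectionVars false
open scoped Pointwise

namespace TOAG

/-! ### Discretely ordered groups with all residues -/

/-- `o` is the least positive element of `G`, and every element has a residue modulo every
positive integer. -/
structure IsZGroup {G : Type*} [AddCommGroup G] [LinearOrder G] (o : G) : Prop where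
  pos : 0 < o
  le_of_pos : ∀ g, 0 < g → o ≤ g
  rem : ∀ n : ℕ, 0 < n → ∀ g, ∃ h : G, ∃ r : ℤ, g = n • h + r • o

namespace IsZGroup

variable {G : Type*} [AddCommGroup G] [LinearOrder G] [IsOrderedAddMonoid G] {o : G}

theorem zsmul_le_zsmul_iff (hG : IsZGroup o) {a b : ℤ} : a • o ≤ b • o ↔ a ≤ b :=
  _root_.zsmul_le_zsmul_iff_left hG.pos

theorem zsmul_inj (hG : IsZGroup o) {a b : ℤ} (h : a • o = b • o) : a = b :=
  le_antisymm (hG.zsmul_le_zsmul_iff.1 h.le) (hG.zsmul_le_zsmul_iff.1 h.ge)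

theorem exists_rem (hG : IsZGroup o) {n : ℕ} (hn : 0 < n) (g : G) :
    ∃ h : G, ∃ r : ℕ, r < n ∧ g = n • h + r • o := by
  obtain ⟨h, r, rfl⟩ := hG.rem n hn g
  have h0 : (0 : ℤ) < n := by exact_mod_cast hn
  refine ⟨h + (r / n) • o, (r % n).toNat, ?_, ?_⟩
  · have := Int.emod_lt_of_pos r h0
    have := Int.emod_nonneg r h0.ne'
    omega
  · have h1 : (((r % n).toNat : ℕ) : ℤ) = r % n := Int.toNat_of_nonneg (Int.emod_nonneg r h0.ne')
    rw [← natCast_zsmul o (r % n).toNat, h1, nsmul_add, ← natCast_zsmul ((r / n) • o) n, smul_smul,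
      add_assoc, ← add_smul, Int.mul_ediv_add_emod]

/-- Discreteness: an element above J•o exceeds it by at least o, so it is at least (J + 1)•o. -/
theorem eq_zsmul_of_le (hG : IsZGroup o) {g : G} (J : ℕ) (h0 : 0 ≤ g) (h1 : g ≤ J • o) :
    ∃ j : ℕ, j ≤ J ∧ g = j • o := by
  induction J with
  | zero => exact ⟨0, le_rfl, by simpa using le_antisymm (by simpa using h1) h0⟩
  | succ J ih =>
    rcases le_or_gt g (J • o) with h | h
    · obtain ⟨j, hj, rfl⟩ := ih h
      exact ⟨j, by omega, rfl⟩
    · refine ⟨J + 1, le_rfl, le_antisymm h1 ?_⟩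
      have := hG.le_of_pos (g - J • o) (sub_pos.2 h)
      rw [succ_nsmul]
      rwa [le_sub_iff_add_le, add_comm] at this

/-- Residues are unique. After reducing r to 0 ≤ r < n, a positive quotient k would make n•k at
least n•o, which is too large, and a nonpositive one forces r = 0. -/
theorem dvd_of_nsmul_eq (hG : IsZGroup o) {n : ℕ} (hn : 0 < n) {h : G} {r : ℤ}
    (e : r • o = n • h) : (n : ℤ) ∣ r := by
  have hn' : (0 : ℤ) < n := by exact_mod_cast hn
  have e1 : (r % n) • o = n • (h - (r / n) • o) := by
    rw [nsmul_sub, ← e, ← natCast_zsmul ((r / n) • o) n, smul_smul, ← sub_smul]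
    congr 1
    have := Int.mul_ediv_add_emod r n
    linarith
  set k := h - (r / n) • o
  have hr0 := Int.emod_nonneg r hn'.ne'
  have hrn := Int.emod_lt_of_pos r hn'
  have hk : ¬ 0 < k := fun hk => by
    have h1 : n • o ≤ n • k := nsmul_le_nsmul_right (hG.le_of_pos k hk) n
    rw [← e1, ← natCast_zsmul, hG.zsmul_le_zsmul_iff] at h1
    omega
  have hk' : n • k ≤ 0 := nsmul_nonpos (not_lt.1 hk) n
  rw [← e1, ← zero_smul ℤ o, hG.zsmul_le_zsmul_iff] at hk'
  exact Int.dvd_of_emod_eq_zero (le_antisymm hk' hr0)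

end IsZGroup

theorem nsmul_injective {G : Type*} [AddCommGroup G] [LinearOrder G] [IsOrderedAddMonoid G]
    {n : ℕ} (hn : 0 < n) {a b : G} (h : n • a = n • b) : a = b :=
  nsmul_right_injective hn.ne' h

/-- Multiplication by c = K / |m| normalizes the coefficient m of a linear form to ±K. -/
theorem nsmul_zsmul_of_pos {A : Type*} [AddCommGroup A] {m : ℤ} (hm : 0 < m) {c K : ℕ}
    (h : K = m.natAbs * c) (x : A) : c • m • x = K • x := by
  rw [← natCast_zsmul, smul_smul, ← natCast_zsmul, h]
  congr 1
  push_cast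
  rw [abs_of_pos hm, mul_comm]

theorem nsmul_zsmul_of_neg {A : Type*} [AddCommGroup A] {m : ℤ} (hm : m < 0) {c K : ℕ}
    (h : K = m.natAbs * c) (x : A) : c • m • x = -(K • x) := by
  rw [← neg_neg m, neg_smul, smul_neg,
    nsmul_zsmul_of_pos (K := K) (neg_pos.2 hm) (by rwa [Int.natAbs_neg])]

/-! ### Similarity of tuples in two ordered groups -/

section Ball

variable {P : Type*} [AddCommGroup P]

/-- The sums of `N` elements of `X ∪ -X ∪ {0}`. -/
def ball (X : Set P) : ℕ → Set P
  | 0 => {0}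
  | N + 1 => {p | ∃ q ∈ ball X N, ∃ e, (e ∈ X ∨ -e ∈ X ∨ e = 0) ∧ p = q + e}

variable {X Y : Set P} {p q : P} {M N : ℕ}

theorem zero_mem_ball (X : Set P) (N : ℕ) : (0 : P) ∈ ball X N := by
  induction N with
  | zero => rfl
  | succ N ih => exact ⟨0, ih, 0, by simp, by simp⟩

theorem add_mem_ball (hp : p ∈ ball X M) (hq : q ∈ ball X N) : p + q ∈ ball X (M + N) := by
  induction N generalizing q with
  | zero => obtain rfl : q = 0 := hq; simpa using hp
  | succ N ih =>
    obtain ⟨q, hq, e, he, rfl⟩ := hq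
    exact ⟨p + q, ih hq, e, he, (add_assoc _ _ _).symm⟩

theorem ball_mono (h : M ≤ N) (hp : p ∈ ball X M) : p ∈ ball X N := by
  obtain ⟨k, rfl⟩ := Nat.exists_eq_add_of_le h
  simpa using add_mem_ball hp (zero_mem_ball X k)

theorem ball_subset (h : X ⊆ Y) : ball X N ⊆ ball Y N := by
  induction N with
  | zero => exact le_rfl
  | succ N ih =>
    rintro _ ⟨q, hq, e, he, rfl⟩
    exact ⟨q, ih hq, e, he.imp (@h _) (Or.imp_left (@h _)), rfl⟩

theorem neg_mem_ball (hp : p ∈ ball X N) : -p ∈ ball X N := by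
  induction N generalizing p with
  | zero => obtain rfl : p = 0 := hp; exact neg_zero
  | succ N ih =>
    obtain ⟨q, hq, e, he, rfl⟩ := hp
    exact ⟨-q, ih hq, -e, by rcases he with he | he | he <;> simp [he], by abel⟩

theorem sub_mem_ball (hp : p ∈ ball X M) (hq : q ∈ ball X N) : p - q ∈ ball X (M + N) := by
  simpa [sub_eq_add_neg] using add_mem_ball hp (neg_mem_ball hq)

theorem mem_ball_one (hp : p ∈ X) : p ∈ ball X 1 := ⟨0, rfl, p, Or.inl hp, by simp⟩

theorem nsmul_mem_ball (k : ℕ) (hp : p ∈ ball X N) : k • p ∈ ball X (k * N) := by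
  induction k with
  | zero => simpa using zero_mem_ball X 0
  | succ k ih => rw [succ_nsmul, Nat.succ_mul]; exact add_mem_ball ih hp

theorem finite_ball (hX : X.Finite) (N : ℕ) : (ball X N).Finite := by
  induction N with
  | zero => exact Set.finite_singleton 0
  | succ N ih =>
    refine (ih.image2 (· + ·) ((hX.union hX.neg).union (Set.finite_singleton 0))).subset ?_
    rintro _ ⟨q, hq, e, he, rfl⟩
    exact ⟨q, hq, e, by rcases he with he | he | he <;> simp [he], rfl⟩

theorem ball_insert {e : P} (hp : p ∈ ball (insert e X) N) :
    ∃ q ∈ ball X N, ∃ m : ℤ, |m| ≤ N ∧ p = q + m • e := by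
  induction N generalizing p with
  | zero => exact ⟨0, rfl, 0, by simp, by simpa [ball] using hp⟩
  | succ N ih =>
    obtain ⟨q', hq', e', he, rfl⟩ := hp
    obtain ⟨q, hq, m, hm, rfl⟩ := ih hq'
    rcases he with (rfl | he) | (he | he) | rfl
    · exact ⟨q, ball_mono (Nat.le_succ N) hq, m + 1,
        (abs_add_le m 1).trans (by push_cast; simpa using hm), by rw [add_smul, one_smul]; abel⟩
    · exact ⟨q + e', ⟨q, hq, e', Or.inl he, rfl⟩, m, hm.trans (by simp), by abel⟩
    · obtain rfl : e' = -e := neg_eq_iff_eq_neg.1 he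
      exact ⟨q, ball_mono (Nat.le_succ N) hq, m - 1,
        (abs_sub m 1).trans (by push_cast; simpa using hm), by rw [sub_smul, one_smul]; abel⟩
    · exact ⟨q + e', ⟨q, hq, e', Or.inr (Or.inl he), rfl⟩, m, hm.trans (by simp), by abel⟩
    · exact ⟨q, ball_mono (Nat.le_succ N) hq, m, hm.trans (by simp), by simp⟩

theorem map_ball {Q : Type*} [AddCommGroup Q] (f : P →+ Q) (hp : p ∈ ball X N) :
    f p ∈ ball (f '' X) N := by
  induction N generalizing p with
  | zero => obtain rfl : p = 0 := hp; simpa using zero_mem_ball (f '' X) 0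
  | succ N ih =>
    obtain ⟨q, hq, e, he, rfl⟩ := hp
    refine ⟨f q, ih hq, f e, ?_, by simp⟩
    rcases he with he | he | rfl
    · exact Or.inl ⟨e, he, rfl⟩
    · exact Or.inr (Or.inl ⟨-e, he, by simp⟩)
    · simp

end Ball

/-! ### Similar sets of pairs and the one-element extension -/

section Sim

variable {G : Type*} [AddCommGroup G] {H : Type*} [AddCommGroup H] {o : G} {o' : H}

/-- The two components of `p` have a common integer residue modulo `n`. -/
def ResEq (o : G) (o' : H) (n : ℕ) (p : G × H) : Prop :=
  ∃ r : ℤ, (∃ h, p.1 = n • h + r • o) ∧ ∃ h, p.2 = n • h + r • o'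

theorem ResEq.zero {n : ℕ} : ResEq o o' n 0 := ⟨0, ⟨0, by simp⟩, ⟨0, by simp⟩⟩

theorem ResEq.neg {n : ℕ} {p : G × H} : ResEq o o' n p → ResEq o o' n (-p) := by
  rintro ⟨r, ⟨h, e⟩, ⟨h', e'⟩⟩
  exact ⟨-r, ⟨-h, by simp [e]; abel⟩, ⟨-h', by simp [e']; abel⟩⟩

theorem ResEq.add {n : ℕ} {p q : G × H} : ResEq o o' n p → ResEq o o' n q →
    ResEq o o' n (p + q) := by
  rintro ⟨r, ⟨h, e⟩, ⟨h', e'⟩⟩ ⟨s, ⟨k, f⟩, ⟨k', f'⟩⟩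
  exact ⟨r + s, ⟨h + k, by simp only [Prod.fst_add, e, f, nsmul_add, add_smul]; abel⟩,
    ⟨h' + k', by simp only [Prod.snd_add, e', f', nsmul_add, add_smul]; abel⟩⟩

theorem ResEq.of_dvd {m n : ℕ} {p : G × H} (hmn : m ∣ n) : ResEq o o' n p → ResEq o o' m p := by
  obtain ⟨k, rfl⟩ := hmn
  rintro ⟨r, ⟨h, e⟩, ⟨h', e'⟩⟩
  exact ⟨r, ⟨k • h, by rw [e, mul_smul]⟩, ⟨k • h', by rw [e', mul_smul]⟩⟩

theorem ResEq.of_mem_ball {n N : ℕ} {X : Set (G × H)} (hX : ∀ p ∈ X, ResEq o o' n p) {p : G × H}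
    (hp : p ∈ ball X N) : ResEq o o' n p := by
  induction N generalizing p with
  | zero => obtain rfl : p = 0 := hp; exact .zero
  | succ N ih =>
    obtain ⟨q, hq, e, he, rfl⟩ := hp
    refine (ih hq).add ?_
    rcases he with he | he | rfl
    · exact hX e he
    · simpa using (hX _ he).neg
    · exact .zero

variable [LinearOrder G] [IsOrderedAddMonoid G] [LinearOrder H] [IsOrderedAddMonoid H]

/-- The components of the elements of `X` satisfy the same linear inequalities with coefficients of
total size at most `N`, and the same congruences with moduli at most `N`. -/
structure Sim (o : G) (o' : H) (X : Set (G × H)) (N : ℕ) : Prop where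
  sign : ∀ p ∈ ball X N, 0 ≤ p.1 ↔ 0 ≤ p.2
  res : ∀ p ∈ X, ∀ n, 0 < n → n ≤ N → ResEq o o' n p

variable {X Y : Set (G × H)} {M N : ℕ}

theorem Sim.mono (h : Sim o o' X N) (hMN : M ≤ N) : Sim o o' X M :=
  ⟨fun p hp => h.sign p (ball_mono hMN hp), fun p hp n h0 hn => h.res p hp n h0 (hn.trans hMN)⟩

theorem Sim.subset (h : Sim o o' X N) (hY : Y ⊆ X) : Sim o o' Y N :=
  ⟨fun p hp => h.sign p (ball_subset hY hp), fun p hp => h.res p (hY hp)⟩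

theorem Sim.swap (h : Sim o o' X N) : Sim o' o (Prod.swap '' X) N := by
  constructor
  · intro p hp
    have := map_ball (AddEquiv.prodComm (M := H) (N := G)).toAddMonoidHom hp
    rw [Set.image_image] at this
    have := h.sign p.swap (by simpa using this)
    exact this.symm
  · rintro _ ⟨p, hp, rfl⟩ n h0 hn
    obtain ⟨r, h1, h2⟩ := h.res p hp n h0 hn
    exact ⟨r, h2, h1⟩

theorem Sim.le_iff (h : Sim o o' X N) {p q : G × H} {a b : ℕ} (hp : p ∈ ball X a)
    (hq : q ∈ ball X b) (hab : b + a ≤ N) : p.1 ≤ q.1 ↔ p.2 ≤ q.2 := by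
  simpa using h.sign _ (ball_mono hab (sub_mem_ball hq hp))

theorem Sim.lt_iff (h : Sim o o' X N) {p q : G × H} {a b : ℕ} (hp : p ∈ ball X a)
    (hq : q ∈ ball X b) (hab : a + b ≤ N) : p.1 < q.1 ↔ p.2 < q.2 := by
  simpa using (h.le_iff hq hp hab).not

/-- A pair `(a, b)` can be added if `K • a` and `K • b` lie in the same position to `ball X (K * N)`
and `a`, `b` have the same residues. -/
theorem Sim.insert_of {K : ℕ} (hX : Sim o o' X N) (hK : ∀ n, 0 < n → n ≤ N → n ∣ K) (hK0 : 0 < K)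
    {a : G} {b : H}
    (hab : ∀ p ∈ ball X (K * N), (p.1 ≤ K • a ↔ p.2 ≤ K • b) ∧ (K • a ≤ p.1 ↔ K • b ≤ p.2))
    (hres : ResEq o o' K (a, b)) : Sim o o' (insert (a, b) X) N := by
  constructor
  · intro p hp
    obtain ⟨q, hq, m, hm, rfl⟩ := ball_insert hp
    rcases eq_or_ne m 0 with rfl | hm0
    · simpa using hX.sign q hq
    -- With c = K / |m|, the sign of q + m•a becomes a comparison of K•a with c•q or -(c•q). Since c
    -- ≤ K, these lie in `ball X (K * N)`.
    obtain ⟨c, hc⟩ := hK m.natAbs (by omega) (by rw [Int.abs_eq_natAbs] at hm; exact_mod_cast hm)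
    have hc0 : 0 < c := Nat.pos_of_ne_zero fun h => by simp [h] at hc; omega
    have hcK : c ≤ K := hc ▸ Nat.le_mul_of_pos_left c (by omega)
    have hcq : c • q ∈ ball X (K * N) :=
      ball_mono (Nat.mul_le_mul_right N hcK) (nsmul_mem_ball c hq)
    simp only [Prod.fst_add, Prod.snd_add, Prod.smul_fst, Prod.smul_snd]
    rw [← nsmul_nonneg_iff (x := q.1 + m • a) hc0.ne', ← nsmul_nonneg_iff (x := q.2 + m • b) hc0.ne',
      nsmul_add, nsmul_add]
    rcases lt_or_gt_of_ne hm0 with h | h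
    · rw [nsmul_zsmul_of_neg h hc, nsmul_zsmul_of_neg h hc, ← sub_eq_add_neg, ← sub_eq_add_neg,
        sub_nonneg, sub_nonneg]
      exact (hab _ hcq).2
    · rw [nsmul_zsmul_of_pos h hc, nsmul_zsmul_of_pos h hc, ← neg_le_iff_add_nonneg',
        ← neg_le_iff_add_nonneg']
      exact (hab _ (neg_mem_ball hcq)).1
  · rintro p (rfl | hp) n h0 hn
    · exact hres.of_dvd (hK n h0 hn)
    · exact hX.res p hp n h0 hn

/-- If b has residue r modulo K, then K•b has residue K r modulo K², and every element with that
residue arises in this way. Such elements occur in every half-open interval of length K²•o'. -/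
theorem exists_nsmul_mem_Ioc (hH : IsZGroup o') {K : ℕ} (hK : 0 < K) (r : ℤ) (h₀ : H) :
    ∃ b c : H, b = K • c + r • o' ∧ h₀ < K • b ∧ K • b ≤ h₀ + (K * K) • o' := by
  obtain ⟨q, s, hs, e⟩ := hH.exists_rem (Nat.mul_pos hK hK) (h₀ - K • r • o')
  -- With q alone, K•b would equal h₀ - s•o' for some 0 ≤ s < K². The extra o' adds K²•o' and so
  -- moves it strictly above h₀.
  refine ⟨K • (q + o') + r • o', q + o', rfl, ?_⟩
  have h1 : K • (K • (q + o') + r • o') = h₀ + ((K * K) • o' - s • o') := by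
    rw [nsmul_add, smul_smul, nsmul_add]
    have : (K * K) • q = h₀ - K • r • o' - s • o' := by rw [e]; abel
    rw [this]; abel
  rw [h1]
  constructor
  · rw [lt_add_iff_pos_right, sub_pos]
    exact nsmul_lt_nsmul_left hH.pos hs
  · rw [add_le_add_iff_left, sub_le_self_iff]
    exact nsmul_nonneg hH.pos.le s

/-- The amount of similarity needed to add a pair to a set of pairs with similarity `N`. -/
def extendBound (N : ℕ) : ℕ :=
  2 * (N.factorial * N + N.factorial * N.factorial) + N.factorial * N.factorial +
    N.factorial * N + N + 1

/-- With K = N!, only the position of K•a relative to the finite set `ball X (K * N)` and the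
residue of a modulo K matter. Either K•a lies at most K²•o above a point of this set, and b is
obtained by dividing the corresponding point by K, or it lies in a gap longer than K²•o, and the
corresponding gap has room for some K•b with b of the right residue. -/
theorem Sim.exists_insert (hG : IsZGroup o) (hH : IsZGroup o') {t : G} {t' : H} (hX : X.Finite)
    (ho : (o, o') ∈ X) (ht : (t, t') ∈ X) (hN : 0 < N) (h : Sim o o' X (extendBound N)) {a : G}
    (ha : 0 ≤ a) (hat : a ≤ t) : ∃ b, Sim o o' (insert (a, b) X) N := by
  set K := N.factorial with hKdef
  have hK0 : 0 < K := N.factorial_pos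
  have hK : ∀ n, 0 < n → n ≤ N → n ∣ K := fun n h0 hn => Nat.dvd_factorial h0 hn
  have hb : extendBound N = 2 * (K * N + K * K) + K * K + K * N + N + 1 := rfl
  have hob : ∀ j : ℕ, j • (o, o') ∈ ball X j := fun j => by
    simpa using nsmul_mem_ball j (mem_ball_one ho)
  have hXN : Sim o o' X N := h.mono (by omega)
  by_cases hs : ∃ p₀ ∈ ball X (K * N), ∃ j : ℕ, j ≤ K * K ∧ K • a = p₀.1 + j • o
  · obtain ⟨p₀, hp₀, j, hj, e⟩ := hs
    have he : p₀ + j • (o, o') ∈ ball X (K * N + K * K) :=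
      add_mem_ball hp₀ (ball_mono hj (hob j))
    -- The residue is taken modulo K² because division by K has to leave a residue modulo K. As K•a
    -- is a multiple of K, so is r, and s = r / K is the residue of a.
    obtain ⟨r, ⟨g, hg⟩, ⟨k, hk⟩⟩ :=
      ResEq.of_mem_ball (fun p hp => h.res p hp (K * K) (by positivity) (by omega)) he
    have hr : (K : ℤ) ∣ r := hG.dvd_of_nsmul_eq hK0 (h := a - K • g) <| by
      rw [nsmul_sub, e, smul_smul, eq_sub_iff_add_eq, add_comm, ← hg]; rfl
    obtain ⟨s, rfl⟩ := hr
    have hb' : K • (K • k + s • o') = (p₀ + j • (o, o')).2 := by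
      rw [hk, nsmul_add, mul_smul (K : ℤ), natCast_zsmul, smul_smul]
    have ha' : K • a = (p₀ + j • (o, o')).1 := e
    refine ⟨K • k + s • o', hXN.insert_of hK hK0 ?_ ⟨s, ⟨g, ?_⟩, ⟨k, rfl⟩⟩⟩
    · intro p hp
      rw [hb', ha']
      exact ⟨h.le_iff hp he (by omega), h.le_iff he hp (by omega)⟩
    · refine nsmul_injective hK0 ?_
      rw [ha', hg, nsmul_add, mul_smul (K : ℤ), natCast_zsmul, smul_smul]
  -- The far case. The neighbours p₀ and p₁ of K•a exist because 0 and K•(t, t') bound it on both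
  -- sides.
  · have hfin := finite_ball hX (K * N)
    obtain ⟨p₀, ⟨hp₀, hp₀a⟩, hmax⟩ := (hfin.subset
      (Set.sep_subset _ fun p => p.1 ≤ K • a)).exists_maximalFor Prod.fst _
      ⟨0, zero_mem_ball X _, by simpa using nsmul_nonneg ha K⟩
    have htb : K • (t, t') ∈ ball X (K * N) :=
      ball_mono (Nat.mul_le_mul_left K hN) (nsmul_mem_ball K (mem_ball_one ht))
    obtain ⟨p₁, ⟨hp₁, hp₁a⟩, hmin⟩ := (hfin.subset
      (Set.sep_subset _ fun p => K • a ≤ p.1)).exists_minimalFor Prod.fst _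
      ⟨_, htb, nsmul_le_nsmul_right hat K⟩
    have hlt : p₀.1 + (K * K) • o < K • a := by
      by_contra hc
      obtain ⟨j, hj, e⟩ := hG.eq_zsmul_of_le (g := K • a - p₀.1) (K * K) (sub_nonneg.2 hp₀a)
        (by rw [sub_le_iff_le_add']; exact not_lt.1 hc)
      exact hs ⟨p₀, hp₀, j, hj, by rw [← e]; abel⟩
    -- The inequality saying that the gap is longer than K²•o is itself a linear inequality, so it
    -- transfers to H.
    have hlt' : p₀.2 + (K * K) • o' < p₁.2 :=
      (h.lt_iff (add_mem_ball hp₀ (hob (K * K))) hp₁ (by omega)).1 (hlt.trans_le hp₁a)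
    obtain ⟨g, r, hg⟩ := hG.rem K hK0 a
    obtain ⟨b, c, hbc, hb₀, hb₁⟩ := exists_nsmul_mem_Ioc hH hK0 r p₀.2
    refine ⟨b, hXN.insert_of hK hK0 ?_ ⟨r, ⟨g, hg⟩, ⟨c, hbc⟩⟩⟩
    intro p hp
    have hne : K • a ≠ p.1 := fun e => hs ⟨p, hp, 0, by omega, by simp [e]⟩
    have below : p.1 ≤ K • a → p.2 < K • b := fun hpa => by
      have : p.1 ≤ p₀.1 := by
        by_contra hc
        exact hc (hmax ⟨hp, hpa⟩ (not_le.1 hc).le)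
      exact ((h.le_iff hp hp₀ (by omega)).1 this).trans_lt hb₀
    have above : K • a ≤ p.1 → K • b < p.2 := fun hpa => by
      have : p₁.1 ≤ p.1 := by
        by_contra hc
        exact hc (hmin ⟨hp, hpa⟩ (not_le.1 hc).le)
      exact (hb₁.trans_lt hlt').trans_le ((h.le_iff hp₁ hp (by omega)).1 this)
    exact ⟨⟨fun hc => (below hc).le, fun hc => by
        by_contra h'; exact (above (not_le.1 h').le).not_ge hc⟩,
      ⟨fun hc => (above hc).le, fun hc => by
        by_contra h'; exact (below (not_le.1 h').le).not_ge hc⟩⟩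

end Sim

end TOAG

namespace TOAG

/-! ### The ordered group generated by a truncated ordered group -/

/-- The algebraic content of the axioms of `presTOAG`. -/
class TruncGroup (M : Type*) extends AddCommMonoid M, Sub M, One M, LinearOrder M where
  topElt : M
  nonneg (x : M) : 0 ≤ x
  le_top (x : M) : x ≤ topElt
  add_top (x : M) : x + topElt = topElt
  add_le {x y z w : M} : x ≤ y → z ≤ w → x + z ≤ y + w
  cancel {x y z : M} : x + y = x + z → x + y < topElt → y = z
  add_sub {x y : M} : x ≤ y → y < topElt → x + (y - x) = y
  sub_zero {x y : M} : y ≤ x → y - x = 0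
  compl {x : M} : 0 < x → ∃ z, z < topElt ∧ x + z = topElt
  add_top_sub (x : M) : x + (topElt - x) = topElt
  top_sub_le {x z : M} : x + z = topElt → topElt - x ≤ z
  top_sub_top_sub (x : M) : topElt - (topElt - x) = x
  carry_comm {x y : M} : x < topElt → y < topElt → x + y = topElt → y - (topElt - x) = x - (topElt - y)
  carry_assoc₁ {x y z : M} : y + z < topElt → x + (y + z) = topElt → y + x < topElt →
    x - (topElt - (y + z)) = z - (topElt - (x + y))
  carry_assoc₂ {x y z : M} : y + z < topElt → x + (y + z) = topElt → x + y = topElt →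
    z + (y - (topElt - x)) < topElt → x - (topElt - (y + z)) = z + (y - (topElt - x))
  carry_lt {x y z : M} : y + x = topElt → y + z < topElt → z + (y - (topElt - x)) < topElt
  carry_assoc₃ {x y z : M} : y + z = topElt → y + x = topElt → z + (y - (topElt - x)) < topElt →
    x + (y - (topElt - z)) = (x - (topElt - y)) + z
  carry_top {x y z : M} : y + z = topElt → y + x = topElt → x + (y - (topElt - z)) = topElt →
    z + (y - (topElt - x)) = topElt
  carry_assoc₄ {x y z : M} : y + z = topElt → y + x = topElt → x + (y - (topElt - z)) = topElt →
    y - (topElt - x) - (topElt - z) = y - (topElt - z) - (topElt - x)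
  zero_lt_unit : (0 : M) < 1
  one_le {x : M} : 0 < x → 1 ≤ x
  rem (n : ℕ) (hn : 1 ≤ n) (x : M) : ∃ y : M, ∃ m, m < n ∧ x = n • y + m • (1 : M)

namespace TruncGroup

variable {M : Type*} [TruncGroup M] {a b c : M}

theorem top_pos : (0 : M) < topElt := zero_lt_unit.trans_le (le_top 1)

theorem lt_or_eq_top (a : M) : a < topElt ∨ a = topElt := (le_top a).lt_or_eq

theorem lt_of_add_lt_left (h : a + b < topElt) : a < topElt :=
  (le_top a).lt_of_ne fun e => h.ne (by rw [e, add_comm, add_top])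

theorem lt_of_add_lt_right (h : a + b < topElt) : b < topElt :=
  (le_top b).lt_of_ne fun e => h.ne (by rw [e, add_top])

theorem not_lt_iff : ¬ a < topElt ↔ a = topElt :=
  ⟨fun h => (lt_or_eq_top a).resolve_left h, fun h => h ▸ lt_irrefl _⟩

theorem carry_le (hb : b < topElt) (h : a + b = topElt) : b - (topElt - a) ≤ b := by
  have := add_sub (top_sub_le h) hb
  calc b - (topElt - a) = 0 + (b - (topElt - a)) := (zero_add _).symm
    _ ≤ (topElt - a) + (b - (topElt - a)) := add_le (nonneg _) le_rfl
    _ = b := this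

theorem top_sub_zero : topElt - (0 : M) = topElt := by
  simpa using add_top_sub (0 : M)

theorem top_sub_lt (ha : 0 < a) : topElt - a < topElt := by
  obtain ⟨z, hz, e⟩ := compl ha
  exact (top_sub_le e).trans_lt hz

end TruncGroup

open TruncGroup

/-- The element `coeff * τ + rest` of the group generated by `M`. -/
@[ext]
structure GroupExt (M : Type*) [TruncGroup M] where
  coeff : ℤ
  rest : M
  rest_lt : rest < topElt

namespace GroupExt

variable {M : Type*} [TruncGroup M]

instance : Zero (GroupExt M) := ⟨⟨0, 0, top_pos⟩⟩

/-- When the rests x and y sum to at least τ, one τ is carried, and the remaining x + y - τ is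
written y ∸ (τ ∸ x). -/
noncomputable instance : Add (GroupExt M) where
  add p q :=
    { coeff := p.coeff + q.coeff + if p.rest + q.rest < topElt then 0 else 1
      rest := if p.rest + q.rest < topElt then p.rest + q.rest else q.rest - (topElt - p.rest)
      rest_lt := by
        split_ifs with h
        · exact h
        · exact (carry_le q.rest_lt (not_lt_iff.1 h)).trans_lt q.rest_lt }

noncomputable instance : Neg (GroupExt M) where
  neg p :=
    { coeff := if p.rest = 0 then -p.coeff else -p.coeff - 1
      rest := if p.rest = 0 then 0 else topElt - p.rest
      rest_lt := by
        split_ifs with h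
        · exact top_pos
        · exact top_sub_lt ((nonneg _).lt_of_ne' h) }

@[simp] theorem coeff_zero : (0 : GroupExt M).coeff = 0 := rfl
@[simp] theorem rest_zero : (0 : GroupExt M).rest = 0 := rfl

theorem coeff_add (p q : GroupExt M) :
    (p + q).coeff = p.coeff + q.coeff + if p.rest + q.rest < topElt then 0 else 1 := rfl

theorem rest_add (p q : GroupExt M) : (p + q).rest =
    if p.rest + q.rest < topElt then p.rest + q.rest else q.rest - (topElt - p.rest) := rfl

theorem coeff_neg (p : GroupExt M) :
    (-p).coeff = if p.rest = 0 then -p.coeff else -p.coeff - 1 := rfl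

theorem rest_neg (p : GroupExt M) : (-p).rest = if p.rest = 0 then 0 else topElt - p.rest := rfl

protected theorem add_comm (p q : GroupExt M) : p + q = q + p := by
  have e : p.rest + q.rest = q.rest + p.rest := _root_.add_comm _ _
  ext
  · rw [coeff_add, coeff_add, e, _root_.add_comm p.coeff]
  · rw [rest_add, rest_add, e]
    split_ifs with h
    · rfl
    · exact carry_comm p.rest_lt q.rest_lt (not_lt_iff.1 (e ▸ h))

/-- The cases are distinguished by which of x + y and y + z overflow, and then by whether adding the
third rest overflows again. In each case a carry axiom, after commutations, identifies the two rests
and makes the numbers of carries agree. -/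
protected theorem add_assoc (p q r : GroupExt M) : p + q + r = p + (q + r) := by
  obtain ⟨k, x, hx⟩ := p
  obtain ⟨l, y, hy⟩ := q
  obtain ⟨m, z, hz⟩ := r
  have exy : x + y = y + x := add_comm _ _
  have eyz : y + z = z + y := add_comm _ _
  rw [GroupExt.ext_iff]
  simp only [coeff_add, rest_add]
  rcases lt_or_eq_top (x + y) with h1 | h1 <;> rcases lt_or_eq_top (y + z) with h2 | h2
  · simp only [h1, h2, if_true]
    rw [add_assoc x y z]
    rcases lt_or_eq_top (x + (y + z)) with h3 | h3
    · simp only [h3, if_true]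
      exact ⟨by ring, trivial⟩
    · simp only [h3, lt_irrefl, if_false]
      refine ⟨by ring, ?_⟩
      rw [carry_comm hx h2 h3]
      exact (carry_assoc₁ h2 h3 (exy ▸ h1)).symm
  · have h3 : x + y + z = topElt := by rw [add_assoc, h2, TruncGroup.add_top]
    have h4 : x + (y - (topElt - z)) < topElt := carry_lt h2 (exy ▸ h1)
    have h5 : x + (z - (topElt - y)) < topElt := by rwa [carry_comm hy hz h2]
    simp only [h1, h2, h3, h5, lt_irrefl, if_true, if_false]
    refine ⟨by ring, ?_⟩
    rw [carry_comm hy hz h2, exy]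
    refine carry_assoc₂ (exy ▸ h1) ?_ (eyz ▸ h2) h4
    rw [← exy, add_comm z, h3]
  · have h3 : x + (y + z) = topElt := by rw [← add_assoc, h1, add_comm, TruncGroup.add_top]
    have h4 : z + (y - (topElt - x)) < topElt := carry_lt (exy ▸ h1) h2
    have h5 : (y - (topElt - x)) + z < topElt := by rwa [add_comm]
    simp only [h1, h2, h3, h5, lt_irrefl, if_true, if_false]
    refine ⟨by ring, ?_⟩
    rw [carry_comm hx h2 h3, add_comm _ z]
    exact (carry_assoc₂ h2 h3 h1 h4).symm
  · have e := carry_comm hy hz h2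
    simp only [h1, h2, lt_irrefl, if_false]
    rw [e, add_comm _ z]
    rcases lt_or_eq_top (z + (y - (topElt - x))) with h3 | h3
    · have h4 : x + (y - (topElt - z)) < topElt := by
        by_contra h
        exact h3.ne (carry_top h2 (exy ▸ h1) (not_lt_iff.1 h))
      simp only [h3, h4, if_true]
      refine ⟨by ring, ?_⟩
      rw [carry_assoc₃ h2 (exy ▸ h1) h3, ← carry_comm hx hy h1, add_comm]
    · have h4 : x + (y - (topElt - z)) = topElt := carry_top (exy ▸ h1) h2 h3
      simp only [h3, h4, lt_irrefl, if_false]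
      refine ⟨by ring, ?_⟩
      rw [← carry_assoc₄ h2 (exy ▸ h1) h4]
      refine (carry_comm ?_ hz (by rwa [add_comm])).symm ▸ rfl
      exact (carry_le hy h1).trans_lt hy

noncomputable instance : AddCommGroup (GroupExt M) where
  add_assoc := GroupExt.add_assoc
  zero_add p := by
    ext <;> simp [coeff_add, rest_add, p.rest_lt]
  add_zero p := by
    ext <;> simp [coeff_add, rest_add, p.rest_lt]
  add_comm := GroupExt.add_comm
  neg_add_cancel p := by
    ext
    · by_cases h : p.rest = 0
      · simp [coeff_add, coeff_neg, rest_neg, h, top_pos]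
      · have := add_top_sub p.rest
        rw [add_comm] at this
        simp only [coeff_add, coeff_neg, rest_neg, h, this, if_false, lt_irrefl, coeff_zero]
        ring
    · by_cases h : p.rest = 0
      · simp [rest_add, rest_neg, h, top_pos]
      · have := add_top_sub p.rest
        rw [add_comm] at this
        simp [rest_add, rest_neg, h, this, top_sub_top_sub, TruncGroup.sub_zero le_rfl]
  nsmul := nsmulRec
  zsmul := zsmulRec

/-- The elements with a nonnegative coefficient. -/
def nonnegCone (M : Type*) [TruncGroup M] : AddGroupCone (GroupExt M) where
  carrier := {p | 0 ≤ p.coeff}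
  zero_mem' := by simp
  add_mem' {p q} hp hq := by
    simp only [Set.mem_ofPred_eq, coeff_add] at *
    split_ifs <;> omega
  -- If the rest is nonzero, the coefficients of p and -p add up to -1, so they cannot both be
  -- nonnegative.
  eq_zero_of_mem_of_neg_mem' {p} hp hq := by
    simp only [Set.mem_ofPred_eq, coeff_neg] at *
    ext
    · rw [coeff_zero]
      split_ifs at hq <;> omega
    · rw [rest_zero]
      split_ifs at hq with h
      · exact h
      · omega

theorem mem_nonnegCone {p : GroupExt M} : p ∈ nonnegCone M ↔ 0 ≤ p.coeff := by
  change p ∈ {p : GroupExt M | 0 ≤ p.coeff} ↔ _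
  rw [Set.mem_ofPred_eq]

instance : HasMemOrNegMem (nonnegCone M) where
  mem_or_neg_mem p := by
    simp only [mem_nonnegCone, coeff_neg]
    split_ifs <;> omega

noncomputable instance : LinearOrder (GroupExt M) :=
  haveI : DecidablePred (· ∈ nonnegCone M) := Classical.decPred _
  LinearOrder.mkOfAddGroupCone (nonnegCone M)

instance : IsOrderedAddMonoid (GroupExt M) := IsOrderedAddMonoid.mkOfCone (nonnegCone M)

theorem le_iff {p q : GroupExt M} : p ≤ q ↔ 0 ≤ (q - p).coeff :=
  mem_nonnegCone

theorem nonneg_iff {p : GroupExt M} : 0 ≤ p ↔ 0 ≤ p.coeff := by rw [le_iff, _root_.sub_zero]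

/-! ### The embedding of a model as the interval from 0 to τ -/

open Classical in
/-- The embedding of `M` onto the interval from `0` to `τ`. -/
noncomputable def of (a : M) : GroupExt M := if h : a < topElt then ⟨0, a, h⟩ else ⟨1, 0, top_pos⟩

theorem of_lt {a : M} (h : a < topElt) : of a = ⟨0, a, h⟩ := dif_pos h

theorem of_top : of (topElt : M) = ⟨1, 0, top_pos⟩ := dif_neg (lt_irrefl _)

theorem of_zero : of (0 : M) = 0 := of_lt top_pos

theorem of_nonneg (a : M) : 0 ≤ of a := by
  rw [nonneg_iff]
  rcases lt_or_eq_top a with h | rfl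
  · rw [of_lt h]
  · rw [of_top]; exact Int.one_nonneg

theorem of_add {a b : M} (h : a + b < topElt) : of (a + b) = of a + of b := by
  rw [of_lt h, of_lt (lt_of_add_lt_left h), of_lt (lt_of_add_lt_right h)]
  ext <;> simp [coeff_add, rest_add, h]

theorem of_injective : Function.Injective (of : M → GroupExt M) := by
  intro a b h
  rcases lt_or_eq_top a with ha | rfl <;> rcases lt_or_eq_top b with hb | rfl
  · rw [of_lt ha, of_lt hb] at h; exact congrArg rest h
  · rw [of_lt ha, of_top] at h; exact absurd (congrArg coeff h) (by simp)
  · rw [of_lt hb, of_top] at h; exact absurd (congrArg coeff h) (by simp)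
  · rfl

theorem of_top_sub (a : M) : of (topElt - a) = of topElt - of a := by
  rw [eq_sub_iff_add_eq]
  rcases (nonneg a).eq_or_lt with rfl | h0
  · rw [top_sub_zero, of_zero, add_zero]
  rcases lt_or_eq_top a with h | rfl
  · have e := add_top_sub a
    rw [add_comm] at e
    rw [of_lt h, of_lt (top_sub_lt h0), of_top]
    ext <;> simp [coeff_add, rest_add, e, top_sub_top_sub, TruncGroup.sub_zero le_rfl]
  · rw [TruncGroup.sub_zero le_rfl, of_zero, zero_add]

theorem of_le_top (a : M) : of a ≤ of topElt := by
  rw [← sub_nonneg, ← of_top_sub]; exact of_nonneg _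

theorem of_sub {a b : M} (h : b ≤ a) : of (a - b) = of a - of b := by
  rcases lt_or_eq_top a with ha | rfl
  · have e := add_sub h ha
    rw [eq_sub_iff_add_eq, add_comm, ← of_add (by rwa [e]), e]
  · exact of_top_sub b

theorem of_le_of {a b : M} : of a ≤ of b ↔ a ≤ b := by
  have key : ∀ {a b : M}, a ≤ b → of a ≤ of b := fun {a b} h => by
    rw [← sub_nonneg, ← of_sub h]; exact of_nonneg _
  refine ⟨fun h => ?_, key⟩
  rcases le_total a b with h' | h'
  · exact h'
  · exact (of_injective (h.antisymm (key h'))).le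

theorem of_add_eq_min (a b : M) : of (a + b) = min (of a + of b) (of topElt) := by
  rcases lt_or_eq_top (a + b) with h | h
  · rw [← of_add h, min_eq_left (of_le_top _)]
  · rw [h, min_eq_right]
    rw [le_iff]
    rcases lt_or_eq_top a with ha | rfl
    · rcases lt_or_eq_top b with hb | rfl
      · rw [← nonneg_iff, sub_nonneg]
        have : of a + of b = of (b - (topElt - a)) + of topElt := by
          rw [of_top, of_lt ha, of_lt hb, of_lt ((carry_le hb h).trans_lt hb)]
          have := (carry_le hb h).trans_lt hb
          ext <;> simp [coeff_add, rest_add, h, this]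
        rw [this]
        exact le_add_of_nonneg_left (of_nonneg _)
      · rw [← nonneg_iff, sub_nonneg]
        exact le_add_of_nonneg_left (of_nonneg _)
    · rw [← nonneg_iff, sub_nonneg]
      exact le_add_of_nonneg_right (of_nonneg _)

theorem of_sub_eq_max (a b : M) : of (a - b) = max (of a - of b) 0 := by
  rcases le_total a b with h | h
  · rw [sub_zero h, of_zero, max_eq_right]
    rw [sub_nonpos]; exact of_le_of.2 h
  · rw [of_sub h, max_eq_left]
    rw [sub_nonneg]; exact of_le_of.2 h

/-- The untruncated x + y - τ is the value of a term, so carries can be computed inside the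
language. -/
theorem of_sub_top_sub {x y : M} (hx : x < topElt) (h : topElt ≤ x + y) :
    x - (topElt - y) < topElt ∧ of (x - (topElt - y)) = of x + of y - of topElt := by
  have e : y + x = topElt := (add_comm y x).trans ((le_top _).antisymm h)
  rw [of_sub (top_sub_le e), of_top_sub]
  exact ⟨(carry_le hx e).trans_lt hx, by abel⟩

theorem sub_lt_top {x y : M} (h : y ≤ x) (hx : x < topElt) : x - y < topElt :=
  lt_of_add_lt_right ((add_sub h hx).trans_lt hx)

theorem sub_pos_of_lt {x y : M} (h : y < x) : 0 < x - y :=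
  (nonneg _).lt_of_ne fun e => by
    have h' := of_sub h.le
    rw [← e, of_zero, eq_comm, sub_eq_zero] at h'
    exact h.ne' (of_injective h')

theorem of_nsmul {n : ℕ} {a : M} (h : n • a < topElt) : of (n • a) = n • of a := by
  induction n with
  | zero => simp [of_zero]
  | succ n ih =>
    rw [succ_nsmul] at h
    rw [succ_nsmul, succ_nsmul, of_add h, ih (lt_of_add_lt_left h)]

theorem eq_add_of (p : GroupExt M) : p = p.coeff • of topElt + of p.rest := by
  have hk : ∀ k : ℕ, k • of (topElt : M) = ⟨k, 0, top_pos⟩ := fun k => by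
    induction k with
    | zero => rw [zero_smul]; rfl
    | succ k ih => rw [succ_nsmul, ih, of_top]; ext <;> simp [coeff_add, rest_add, top_pos]
  have hz : ∀ k : ℤ, k • of (topElt : M) = ⟨k, 0, top_pos⟩ := fun k => by
    obtain ⟨k, rfl | rfl⟩ := k.eq_nat_or_neg
    · rw [natCast_zsmul, hk]
    · rw [neg_smul, natCast_zsmul, hk]; ext <;> simp [coeff_neg, rest_neg]
  rw [hz, of_lt p.rest_lt]
  ext <;> simp [coeff_add, rest_add, p.rest_lt]

/-- A positive coefficient already makes p at least τ. This brings witnesses found in the group back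
into the model. -/
theorem exists_of_eq {p : GroupExt M} (h0 : 0 ≤ p) (h1 : p ≤ of topElt) : ∃ a, of a = p := by
  rw [nonneg_iff] at h0
  rcases eq_or_ne p.coeff 0 with h | h
  · exact ⟨p.rest, by rw [of_lt p.rest_lt]; ext <;> simp [h]⟩
  · refine ⟨topElt, le_antisymm ?_ h1⟩
    conv_rhs => rw [eq_add_of p]
    calc of topElt ≤ p.coeff • of topElt := le_smul_of_one_le_left (of_nonneg _) (by omega)
      _ ≤ _ := le_add_of_nonneg_right (of_nonneg _)

theorem isZGroup : IsZGroup (of (1 : M)) where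
  pos := by
    rw [← of_zero]
    exact (of_le_of.2 (nonneg _)).lt_of_ne fun e => zero_lt_unit.ne (of_injective e)
  le_of_pos p hp := by
    rcases le_or_gt p (of topElt) with h | h
    · obtain ⟨a, rfl⟩ := exists_of_eq hp.le h
      refine of_le_of.2 (one_le ((nonneg a).lt_of_ne ?_))
      rintro rfl
      exact hp.ne of_zero.symm
    · exact (of_le_top _).trans h.le
  rem n hn := by
    -- Below τ the sum n y + m1 of the remainder axiom cannot have been truncated. For τ itself the
    -- axiom is void (take y = τ and m = 0), so its residue is obtained from τ ∸ 1.
    have key : ∀ a : M, a < topElt → ∃ h : GroupExt M, ∃ r : ℤ, of a = n • h + r • of 1 := by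
      intro a ha
      obtain ⟨y, m, -, e⟩ := rem n hn a
      rw [e] at ha
      exact ⟨of y, m, by rw [e, of_add ha, of_nsmul (lt_of_add_lt_left ha),
        of_nsmul (lt_of_add_lt_right ha), natCast_zsmul]⟩
    intro p
    obtain ⟨h, r, e⟩ := key (topElt - 1) (top_sub_lt zero_lt_unit)
    obtain ⟨h', r', e'⟩ := key p.rest p.rest_lt
    rw [of_top_sub, sub_eq_iff_eq_add] at e
    refine ⟨p.coeff • h + h', p.coeff * (r + 1) + r', ?_⟩
    conv_lhs => rw [eq_add_of p, e, e']
    rw [nsmul_add, smul_comm n p.coeff h]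
    simp only [smul_add, add_smul, mul_smul, one_smul]
    abel

end GroupExt

end TOAG

namespace TOAG

/-! ### Semantics of the axioms -/

/-- Types with a distinguished element, written `topElt`. -/
class HasTop (M : Type*) where
  /-- The interpretation of `τ`. -/
  top : M

/-- The structure `M` interprets the symbols of `toag` by the given operations. -/
class Interp (M : Type*) [toag.Structure M] [Zero M] [One M] [Add M] [Sub M] [LE M] [HasTop M] :
    Prop where
  zero (v : Fin 0 → M) : Structure.funMap (L := toag) ToagFunc.zero v = 0
  one (v : Fin 0 → M) : Structure.funMap (L := toag) ToagFunc.one v = 1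
  tau (v : Fin 0 → M) : Structure.funMap (L := toag) ToagFunc.tau v = HasTop.top
  add (v : Fin 2 → M) : Structure.funMap (L := toag) ToagFunc.add v = v 0 + v 1
  monus (v : Fin 2 → M) : Structure.funMap (L := toag) ToagFunc.monus v = v 0 - v 1
  le (v : Fin 2 → M) : Structure.RelMap (L := toag) ToagRel.le v ↔ v 0 ≤ v 1

section Realize

variable {M : Type*} [toag.Structure M] [Zero M] [One M] [Add M] [Sub M] [LinearOrder M] [HasTop M]
  [Interp M] {α : Type*} (w : α → M)

instance : toag.OrderedStructure M := ⟨Interp.le⟩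

@[simp] theorem realize_zero : (0 : toag.Term α).realize w = 0 := Interp.zero _

@[simp] theorem realize_one : (1 : toag.Term α).realize w = 1 := Interp.one _

@[simp] theorem realize_tau : (tau : toag.Term α).realize w = HasTop.top := Interp.tau _

@[simp] theorem realize_add (s t : toag.Term α) :
    (s + t).realize w = s.realize w + t.realize w := Interp.add _

@[simp] theorem realize_monus (s t : toag.Term α) :
    (s ∸ t).realize w = s.realize w - t.realize w := Interp.monus _

/-- The sum of `n` copies of `a`. -/
def multiple (n : ℕ) (a : M) : M := n.rec 0 fun _ b => b + a

@[simp] theorem realize_mult (n : ℕ) (t : toag.Term α) :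
    (mult n t).realize w = multiple n (t.realize w) := by
  induction n with
  | zero => exact realize_zero w
  | succ n ih => rw [mult, realize_add, ih]; rfl

end Realize

/-- The conditions expressed by the axioms of `presTOAG`. -/
structure PresAxioms (M : Type*) [Zero M] [One M] [Add M] [Sub M] [LinearOrder M] [HasTop M] :
    Prop where
  bounds (x : M) : 0 ≤ x ∧ x ≤ HasTop.top
  add_comm (x y : M) : x + y = y + x
  add_zero_top (x : M) : x + 0 = x ∧ x + HasTop.top = HasTop.top
  add_le (x y z w : M) : x ≤ y → z ≤ w → x + z ≤ y + w
  add_assoc (x y z : M) : x + y + z = x + (y + z)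
  cancel (x y z : M) : x + y = x + z → x + y < HasTop.top → y = z
  diff (x y : M) : x ≤ y → y < HasTop.top → ∃ z, x + z = y ∧ ∀ z', x + z' = y → z' = z
  add_sub (x y : M) : x ≤ y → y < HasTop.top → x + (y - x) = y
  sub_zero (x y : M) : y ≤ x → y - x = 0
  compl (x : M) : 0 < x → ∃ z, z < HasTop.top ∧ x + z = HasTop.top
  compl_min (x : M) : x + (HasTop.top - x) = HasTop.top ∧
    ∀ z, x + z = HasTop.top → HasTop.top - x ≤ z
  compl_compl (x : M) : HasTop.top - (HasTop.top - x) = x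
  carry_comm (x y : M) : x < HasTop.top → y < HasTop.top → x + y = HasTop.top →
    y - (HasTop.top - x) = x - (HasTop.top - y)
  carry_assoc₁ (x y z : M) : y + z < HasTop.top → x + (y + z) = HasTop.top → y + x < HasTop.top →
    x - (HasTop.top - (y + z)) = z - (HasTop.top - (x + y))
  carry_assoc₂ (x y z : M) : y + z < HasTop.top → x + (y + z) = HasTop.top → x + y = HasTop.top →
    z + (y - (HasTop.top - x)) < HasTop.top →
    x - (HasTop.top - (y + z)) = z + (y - (HasTop.top - x))
  carry_lt (x y z : M) : y + x = HasTop.top → y + z < HasTop.top →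
    z + (y - (HasTop.top - x)) < HasTop.top
  carry_assoc₃ (x y z : M) : y + z = HasTop.top → y + x = HasTop.top →
    z + (y - (HasTop.top - x)) < HasTop.top →
    x + (y - (HasTop.top - z)) = (x - (HasTop.top - y)) + z
  carry_top (x y z : M) : y + z = HasTop.top → y + x = HasTop.top →
    x + (y - (HasTop.top - z)) = HasTop.top → z + (y - (HasTop.top - x)) = HasTop.top
  carry_assoc₄ (x y z : M) : y + z = HasTop.top → y + x = HasTop.top →
    x + (y - (HasTop.top - z)) = HasTop.top →
    y - (HasTop.top - x) - (HasTop.top - z) = y - (HasTop.top - z) - (HasTop.top - x)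
  one : (0 : M) < 1 ∧ ∀ x : M, 0 < x → 1 ≤ x
  hasSucc (x : M) : x < HasTop.top → ∃ y, x < y ∧ ∀ z, x < z → y ≤ z
  isSucc (x : M) : 0 < x → ∃ y, y < x ∧ ∀ z, y < z → x ≤ z
  rem (n : ℕ) : 1 ≤ n → ∀ x : M, ∃ y : M, ∃ m : Fin n, x = multiple n y + multiple m 1

theorem model_presTOAG_iff {M : Type*} [toag.Structure M] [Zero M] [One M] [Add M] [Sub M]
    [LinearOrder M] [HasTop M] [Interp M] : M ⊨ presTOAG ↔ PresAxioms M := by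
  have hlin : M ⊨ toag.linearOrderTheory := inferInstance
  have hrem : M ⊨ ({φ | ∃ n : ℕ, 1 ≤ n ∧ φ = axRemainder n} : toag.Theory) ↔
      ∀ n : ℕ, 1 ≤ n → M ⊨ axRemainder n :=
    ⟨fun h n hn => h.realize_of_mem _ ⟨n, hn, rfl⟩,
      fun h => ⟨by rintro _ ⟨n, hn, rfl⟩; exact h n hn⟩⟩
  simp only [presTOAG, toagTheory, Theory.model_union_iff, Theory.model_insert_iff,
    Theory.model_singleton_iff, hlin, hrem, true_and]
  simp [axBounds, axAddComm, axAddZeroTau, axAddMono, axAddAssoc, axCancel, axDiff, axMonusDiff,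
    axMonusZero, axCompl, axComplMin, axComplCompl, axCarryComm, axCarryAssoc₁, axCarryAssoc₂,
    axCarryLt, axCarryAssoc₃, axCarryTau, axCarryAssoc₄, axOne, axHasSucc, axIsSucc, axRemainder,
    Sentence.Realize, Formula.Realize, Fin.snoc]
  constructor
  · rintro ⟨⟨⟨h1, h2, h3, h4, h5, h6, h7, h8, h9, h10, h11, h12, h13, h14, h15, h16, h17, h18,
      h19⟩, h20, h21, h22⟩, h23⟩
    exact ⟨h1, h2, h3, h4, h5, h6, h7, h8, h9, h10, h11, h12, h13, h14, h15, h16, h17, h18,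
      h19, h20, h21, h22, h23⟩
  · rintro ⟨h1, h2, h3, h4, h5, h6, h7, h8, h9, h10, h11, h12, h13, h14, h15, h16, h17, h18,
      h19, h20, h21, h22, h23⟩
    exact ⟨⟨⟨h1, h2, h3, h4, h5, h6, h7, h8, h9, h10, h11, h12, h13, h14, h15, h16, h17, h18,
      h19⟩, h20, h21, h22⟩, h23⟩

/-- A structure satisfying the axioms is a truncated group. -/
@[reducible]
noncomputable def PresAxioms.truncGroup {M : Type*} [Zero M] [One M] [Add M] [Sub M]
    [LinearOrder M] [HasTop M] (h : PresAxioms M) : TruncGroup M where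
  add_assoc := h.add_assoc
  zero_add x := by rw [h.add_comm]; exact (h.add_zero_top x).1
  add_zero x := (h.add_zero_top x).1
  add_comm := h.add_comm
  nsmul := multiple
  nsmul_zero _ := rfl
  nsmul_succ _ _ := rfl
  topElt := HasTop.top
  nonneg x := (h.bounds x).1
  le_top x := (h.bounds x).2
  add_top x := (h.add_zero_top x).2
  add_le := h.add_le _ _ _ _
  cancel := h.cancel _ _ _
  add_sub := h.add_sub _ _
  sub_zero := h.sub_zero _ _
  compl := h.compl _
  add_top_sub x := (h.compl_min x).1
  top_sub_le := (h.compl_min _).2 _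
  top_sub_top_sub := h.compl_compl
  carry_comm := h.carry_comm _ _
  carry_assoc₁ := h.carry_assoc₁ _ _ _
  carry_assoc₂ := h.carry_assoc₂ _ _ _
  carry_lt := h.carry_lt _ _ _
  carry_assoc₃ := h.carry_assoc₃ _ _ _
  carry_top := h.carry_top _ _ _
  carry_assoc₄ := h.carry_assoc₄ _ _ _
  zero_lt_unit := h.one.1
  one_le := h.one.2 _
  rem n hn x := by
    obtain ⟨y, m, e⟩ := h.rem n hn x
    exact ⟨y, m, m.2, e⟩

instance {M : Type*} [TruncGroup M] : HasTop M := ⟨TruncGroup.topElt⟩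

theorem exists_truncGroup {M : Type*} [toag.Structure M] (h : M ⊨ presTOAG) :
    ∃ _ : TruncGroup M, Interp M := by
  classical
  have : M ⊨ toag.linearOrderTheory :=
    h.mono fun φ hφ => Or.inl (Or.inl (Or.inl hφ))
  let : LinearOrder M := toag.linearOrderOfModels M
  let : Zero M := ⟨Structure.funMap (L := toag) ToagFunc.zero ![]⟩
  let : One M := ⟨Structure.funMap (L := toag) ToagFunc.one ![]⟩
  let : HasTop M := ⟨Structure.funMap (L := toag) ToagFunc.tau ![]⟩
  let : Add M := ⟨fun a b => Structure.funMap (L := toag) ToagFunc.add ![a, b]⟩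
  let : Sub M := ⟨fun a b => Structure.funMap (L := toag) ToagFunc.monus ![a, b]⟩
  have h2 : ∀ v : Fin 2 → M, v = ![v 0, v 1] := fun v => by
    funext i; fin_cases i <;> rfl
  have hI : Interp M :=
    ⟨fun v => congrArg _ (Subsingleton.elim _ _), fun v => congrArg _ (Subsingleton.elim _ _),
      fun v => congrArg _ (Subsingleton.elim _ _), fun v => congrArg _ (h2 v),
      fun v => congrArg _ (h2 v), fun v => iff_of_eq (congrArg _ (h2 v))⟩
  exact ⟨(model_presTOAG_iff.1 h).truncGroup, hI⟩

/-! ### Special sentences in truncated groups -/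

section TruncGroup

open TruncGroup GroupExt

variable {M : Type*} [TruncGroup M]

theorem multiple_eq (n : ℕ) (a : M) : multiple n a = n • a := by
  induction n with
  | zero => exact (zero_nsmul a).symm
  | succ n ih => rw [succ_nsmul, ← ih]; rfl

theorem GroupExt.of_nsmul_eq_min (n : ℕ) (a : M) : of (n • a) = min (n • of a) (of topElt) := by
  rcases lt_or_eq_top (n • a) with h | h
  · rw [← of_nsmul h, min_eq_left (of_le_top _)]
  · rw [h, min_eq_right]
    induction n with
    | zero => rw [zero_nsmul] at h; exact absurd h top_pos.ne
    | succ n ih =>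
      rw [succ_nsmul]
      rcases lt_or_eq_top (n • a) with h' | h'
      · rw [← of_nsmul h']
        rw [succ_nsmul] at h
        have := of_add_eq_min (n • a) a
        rw [h] at this
        exact (this.le.trans (min_le_left _ _))
      · exact (ih h').trans (le_add_of_nonneg_right (of_nonneg _))

/-- Congruence modulo `n` in the group generated by `M`. -/
def CongMod (n : ℕ) (a b : M) : Prop := ∃ h : GroupExt M, of a - of b = n • h

/-- Shows that `isMultiple` expresses genuine divisibility in the group. Conversely, a divisor h of
an element d of the interval satisfies 0 ≤ h ≤ d, so it comes from the model. -/
theorem exists_multiple_iff {n : ℕ} (hn : 1 ≤ n) (d : M) :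
    (∃ z, z ≤ d ∧ (n - 1) • z = d - z) ↔ ∃ h : GroupExt M, of d = n • h := by
  obtain ⟨n, rfl⟩ := Nat.exists_eq_add_of_le' hn
  rw [Nat.add_sub_cancel]
  constructor
  · rintro ⟨z, hz, e⟩
    have e' := congrArg of e
    rw [of_nsmul_eq_min, of_sub hz] at e'
    refine ⟨of z, ?_⟩
    rw [succ_nsmul]
    rcases le_or_gt (n • of z) (of topElt) with h | h
    · rw [min_eq_left h] at e'
      rw [e']; abel
    -- Truncation would give d - z = τ, hence z ≤ 0 because d ≤ τ; but then the multiple of z could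
    -- not exceed τ.
    · rw [min_eq_right h.le] at e'
      have h1 := of_le_top d
      have h2 : of z ≤ 0 := by
        rw [← sub_nonneg, zero_sub]
        have : -of z = of topElt - of d := by rw [e']; abel
        rw [this]; exact sub_nonneg.2 h1
      have h3 : n • of z ≤ 0 := nsmul_nonpos h2 n
      exact absurd (h.trans_le h3) (of_nonneg _).not_gt
  · rintro ⟨h, e⟩
    have h0 : 0 ≤ h := (nsmul_nonneg_iff (Nat.succ_ne_zero n)).1 (e ▸ of_nonneg d)
    have h1 : h ≤ of d := by rw [e, succ_nsmul]; exact le_add_of_nonneg_left (nsmul_nonneg h0 n)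
    obtain ⟨z, rfl⟩ := exists_of_eq h0 (h1.trans (of_le_top d))
    have hz := of_le_of.1 h1
    refine ⟨z, hz, of_injective ?_⟩
    rw [of_nsmul_eq_min, of_sub hz, e, succ_nsmul, add_sub_cancel_right, min_eq_left]
    refine le_trans ?_ (of_le_top d)
    rw [e, succ_nsmul]; exact le_add_of_nonneg_right h0

variable [toag.Structure M] [Interp M]

theorem realize_congruent {n : ℕ} (hn : 1 ≤ n) (w : Empty → M) (v : Fin 2 → M) :
    (congruent n).Realize w v ↔ CongMod n (v 0) (v 1) := by
  have key : (congruent n).Realize w v ↔ ∃ z, z ≤ (v 0 - v 1) + (v 1 - v 0) ∧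
      (n - 1) • z = (v 0 - v 1) + (v 1 - v 0) - z := by
    simp [congruent, isMultiple, Fin.snoc, multiple_eq]
  rw [key, exists_multiple_iff hn]
  rcases le_total (v 0) (v 1) with h | h
  · rw [TruncGroup.sub_zero h, zero_add, of_sub h]
    exact ⟨fun ⟨g, e⟩ => ⟨-g, by rw [smul_neg, ← e, neg_sub]⟩,
      fun ⟨g, e⟩ => ⟨-g, by rw [smul_neg, ← e, neg_sub]⟩⟩
  · rw [TruncGroup.sub_zero h, add_zero, of_sub h]
    rfl

/-- By discreteness, (m - 1)1 < τ means m1 ≤ τ. For m = 0 the truncated `m - 1` is 0, and both sides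
hold because 0 < τ. -/
theorem nsmul_one_le_top_iff (m : ℕ) :
    (m - 1) • (1 : M) < topElt ↔ m • of (1 : M) ≤ of topElt := by
  have h0 : 0 < of (topElt : M) := (isZGroup (M := M)).pos.trans_le (of_le_top (1 : M))
  rcases m with _ | m
  · simpa only [Nat.zero_sub, zero_smul] using iff_of_true top_pos h0.le
  · have h1 : m • (1 : M) < topElt ↔ m • of (1 : M) < of topElt := by
      rw [← not_le, ← of_le_of, of_nsmul_eq_min, not_le, min_lt_iff]
      simp
    rw [Nat.add_sub_cancel, h1]
    constructor
    · intro h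
      have := isZGroup.le_of_pos _ (sub_pos.2 h)
      rw [succ_nsmul, add_comm]
      exact le_sub_iff_add_le.1 this
    · intro h
      refine lt_of_lt_of_le ?_ h
      rw [succ_nsmul]
      exact lt_add_of_pos_right _ isZGroup.pos

theorem realize_tauResidue {q : ℕ} (hq : 1 ≤ q) (m : ℕ) :
    M ⊨ tauResidue q m ↔ m • of (1 : M) ≤ of topElt ∧
      ∃ h : GroupExt M, of (topElt : M) - m • of 1 = q • h := by
  have key : M ⊨ tauResidue q m ↔ (m - 1) • (1 : M) < topElt ∧
      ∃ z, z ≤ topElt - m • (1 : M) ∧ (q - 1) • z = topElt - m • (1 : M) - z := by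
    simp [tauResidue, isMultiple, Sentence.Realize, Formula.Realize, Fin.snoc, multiple_eq]
    rfl
  rw [key, nsmul_one_le_top_iff]
  refine and_congr_right fun h => ?_
  rw [exists_multiple_iff hq, of_top_sub, of_nsmul_eq_min, min_eq_left h]

theorem realize_tauEq {n : ℕ} :
    M ⊨ tauEq n ↔ of (topElt : M) = n • of 1 := by
  have key : M ⊨ tauEq n ↔ (n - 1) • (1 : M) < topElt ∧ n • (1 : M) = topElt := by
    simp [tauEq, Sentence.Realize, Formula.Realize, multiple_eq]
    rfl
  rw [key, nsmul_one_le_top_iff, ← (of_injective (M := M)).eq_iff, of_nsmul_eq_min]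
  constructor
  · rintro ⟨h1, h2⟩
    rw [← h2, min_eq_left h1]
  · intro h
    rw [h]
    simp

end TruncGroup

end TOAG

namespace TOAG

/-! ### Similar tuples satisfy the same formulas -/

open TruncGroup GroupExt

/-- The symbols `≡_n` are interpreted as congruences. -/
class InterpCong (M : Type*) [TruncGroup M] [toagCong.Structure M] : Prop where
  cong (n : ℕ) (hn : 2 ≤ n) (v : Fin 2 → M) :
    Structure.RelMap (congSymb n hn) v ↔ CongMod n (v 0) (v 1)

/-- A bound for the coefficients of the linear forms by which a term is given piecewise. -/
def cost {β : Type*} : toagCong.Term β → ℕ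
  | .var _ => 1
  | .func _ ts => 2 + ∑ i, cost (ts i)

/-- The modulus of a relation symbol. -/
def relModulus {l : ℕ} : toagCong.Relations l → ℕ
  | .inl _ => 1
  | .inr (.cong n _) => n

/-- The amount of similarity that is needed to preserve a formula. -/
def depth {α : Type*} : ∀ {n : ℕ}, toagCong.BoundedFormula α n → ℕ
  | _, .falsum => 1
  | _, .equal s t => cost s + cost t
  | _, .rel R ts => relModulus R + ∑ i, cost (ts i)
  | _, .imp φ ψ => max (depth φ) (depth ψ)
  | _, .all φ => extendBound (depth φ + 1)

theorem cost_pos {β : Type*} (t : toagCong.Term β) : 0 < cost t := by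
  cases t <;> simp only [cost] <;> omega

theorem depth_pos {α : Type*} {n : ℕ} (φ : toagCong.BoundedFormula α n) : 0 < depth φ := by
  induction φ with
  | falsum => exact one_pos
  | equal s t => exact Nat.add_pos_left (cost_pos s) _
  | rel R ts =>
    refine Nat.add_pos_left ?_ _
    rcases R with R | ⟨n, hn⟩
    · exact one_pos
    · change 0 < n; omega
  | imp φ ψ h _ => exact h.trans_le (le_max_left _ _)
  | all φ h => exact Nat.succ_pos _

variable {M : Type u} {N : Type v} [TruncGroup M] [TruncGroup N] {α β : Type*}

/-- The pairs of corresponding components of two tuples, together with the constants. -/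
def pairSet (a : β → M) (b : β → N) : Set (GroupExt M × GroupExt N) :=
  {(of 1, of 1), (of topElt, of topElt)} ∪ Set.range fun i => (of (a i), of (b i))

theorem one_mem_pairSet (a : β → M) (b : β → N) : (of 1, of 1) ∈ pairSet a b := by
  simp [pairSet]

theorem top_mem_pairSet (a : β → M) (b : β → N) : (of topElt, of topElt) ∈ pairSet a b := by
  simp [pairSet]

theorem mem_pairSet (a : β → M) (b : β → N) (i : β) : (of (a i), of (b i)) ∈ pairSet a b :=
  Or.inr ⟨i, rfl⟩

theorem finite_pairSet [Finite β] (a : β → M) (b : β → N) : (pairSet a b).Finite :=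
  (Set.toFinite _).union (Set.finite_range _)

theorem swap_image_pairSet (a : β → M) (b : β → N) : Prod.swap '' pairSet a b = pairSet b a := by
  rw [pairSet, Set.image_union, Set.image_pair, ← Set.range_comp]
  rfl

theorem pairSet_snoc_subset {n : ℕ} (v : α → M) (w : α → N) (xs : Fin n → M) (ys : Fin n → N)
    (a : M) (b : N) :
    pairSet (Sum.elim v (Fin.snoc xs a : Fin (n + 1) → M))
        (Sum.elim w (Fin.snoc ys b : Fin (n + 1) → N)) ⊆
      insert (of a, of b) (pairSet (Sum.elim v xs) (Sum.elim w ys)) := by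
  rintro _ (h | ⟨i, rfl⟩)
  · exact Or.inr (Or.inl h)
  · rcases i with i | i
    · exact Or.inr (mem_pairSet (Sum.elim v xs) (Sum.elim w ys) (Sum.inl i))
    · refine Fin.lastCases ?_ (fun i => ?_) i
      · left; simp
      · right
        simpa using mem_pairSet (Sum.elim v xs) (Sum.elim w ys) (Sum.inr i)

/-- The back-and-forth property. -/
theorem exists_extension [Finite α] {n K : ℕ} (hK : 0 < K) {v : α → M} {w : α → N}
    {xs : Fin n → M} {ys : Fin n → N}
    (h : Sim (of 1) (of 1) (pairSet (Sum.elim v xs) (Sum.elim w ys)) (extendBound (K + 1))) (a : M) :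
    ∃ b : N, Sim (of 1) (of 1) (pairSet (Sum.elim v (Fin.snoc xs a : Fin (n + 1) → M))
        (Sum.elim w (Fin.snoc ys b : Fin (n + 1) → N))) K := by
  obtain ⟨g, hg⟩ := Sim.exists_insert isZGroup isZGroup (finite_pairSet _ _) (one_mem_pairSet _ _)
    (top_mem_pairSet _ _) (Nat.succ_pos K) h (of_nonneg a) (of_le_top a)
  have hmem := mem_ball_one (Set.mem_insert (of a, g) (pairSet (Sum.elim v xs) (Sum.elim w ys)))
  have htop := mem_ball_one (Set.mem_insert_of_mem (of a, g)
    (top_mem_pairSet (Sum.elim v xs) (Sum.elim w ys)))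
  -- The comparisons of the new element with 0 and τ need similarity 2 at most, which K + 1 provides
  -- since K is positive. They place g in the interval.
  obtain ⟨b, rfl⟩ := exists_of_eq
    ((hg.le_iff (zero_mem_ball _ 0) hmem (by omega)).1 (of_nonneg a))
    ((hg.le_iff hmem htop (by omega)).1 (of_le_top a))
  exact ⟨b, (hg.subset (pairSet_snoc_subset _ _ _ _ _ _)).mono (Nat.le_succ K)⟩

/-! ### Preservation of terms and formulas -/

variable [toag.Structure M] [Interp M] [toagCong.Structure M] [toagIncl.IsExpansionOn M]
  [toag.Structure N] [Interp N] [toagCong.Structure N] [toagIncl.IsExpansionOn N]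

theorem funMap_inl {l : ℕ} (f : ToagFunc l) (w : Fin l → M) :
    Structure.funMap (L := toagCong) (Sum.inl f) w = Structure.funMap (L := toag) f w :=
  LHom.map_onFunction toagIncl f w

theorem relMap_inl {l : ℕ} (R : ToagRel l) (w : Fin l → M) :
    Structure.RelMap (L := toagCong) (Sum.inl R) w = Structure.RelMap (L := toag) R w :=
  LHom.map_onRelation toagIncl R w

/-- Similarity decides in the same way in both models which branch of each min or max applies, so
both values of a term are given by one and the same linear form. -/
theorem pair_realize_mem_ball {K : ℕ} {a : β → M} {b : β → N}
    (h : Sim (of 1) (of 1) (pairSet a b) K) (t : toagCong.Term β) (ht : cost t ≤ K) :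
    (of (t.realize a), of (t.realize b)) ∈ ball (pairSet a b) (cost t) := by
  induction t with
  | var i => exact mem_ball_one (mem_pairSet a b i)
  | func f ts ih =>
    simp only [cost] at ht ⊢
    have h1 : ∀ i, cost (ts i) ≤ ∑ i, cost (ts i) := fun i =>
      Finset.single_le_sum (f := fun i => cost (ts i)) (fun _ _ => Nat.zero_le _)
        (Finset.mem_univ i)
    have ih' := fun i => ih i ((h1 i).trans (by omega))
    have htop := mem_ball_one (top_mem_pairSet a b)
    rcases f with f | f
    swap
    · exact f.elim
    suffices H : ∀ x y, x = Structure.funMap (L := toag) f (fun i => (ts i).realize a) →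
        y = Structure.funMap (L := toag) f (fun i => (ts i).realize b) →
        (of x, of y) ∈ ball (pairSet a b) (2 + ∑ i, cost (ts i)) from
      H _ _ (funMap_inl f _) (funMap_inl f _)
    rintro _ _ rfl rfl
    cases f with
    | zero =>
      rw [Interp.zero, Interp.zero, of_zero, of_zero]; exact zero_mem_ball _ _
    | one =>
      rw [Interp.one, Interp.one]
      exact ball_mono (by omega) (mem_ball_one (one_mem_pairSet a b))
    | tau =>
      rw [Interp.tau, Interp.tau]
      exact ball_mono (by omega) htop
    | add =>
      rw [Fin.sum_univ_two] at ht ⊢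
      rw [Interp.add, Interp.add, of_add_eq_min, of_add_eq_min]
      have hadd := add_mem_ball (ih' 0) (ih' 1)
      have hle := h.le_iff hadd htop (by omega)
      simp only [Prod.fst_add, Prod.snd_add] at hle
      rcases le_or_gt (of ((ts 0).realize a) + of ((ts 1).realize a)) (of topElt) with hc | hc
      · rw [min_eq_left hc, min_eq_left (hle.1 hc)]
        exact ball_mono (by omega) hadd
      · rw [min_eq_right hc.le, min_eq_right (not_le.1 fun h' => hc.not_ge (hle.2 h')).le]
        exact ball_mono (by omega) htop
    | monus =>
      rw [Fin.sum_univ_two] at ht ⊢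
      rw [Interp.monus, Interp.monus, of_sub_eq_max, of_sub_eq_max]
      have hsub := sub_mem_ball (ih' 0) (ih' 1)
      have hle := h.le_iff hsub (zero_mem_ball _ 0) (by omega)
      simp only [Prod.fst_sub, Prod.snd_sub, Prod.fst_zero, Prod.snd_zero] at hle
      rcases le_or_gt (of ((ts 0).realize a) - of ((ts 1).realize a)) 0 with hc | hc
      · rw [max_eq_right hc, max_eq_right (hle.1 hc)]
        exact zero_mem_ball _ _
      · rw [max_eq_left hc.le, max_eq_left (not_le.1 fun h' => hc.not_ge (hle.2 h')).le]
        exact ball_mono (by omega) hsub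

theorem IsZGroup.exists_nsmul_eq_iff {G : Type*} [AddCommGroup G] [LinearOrder G]
    [IsOrderedAddMonoid G] {o : G} (hG : IsZGroup o) {n : ℕ} (hn : 0 < n) {x h : G} {r : ℤ}
    (e : x = n • h + r • o) : (∃ g, x = n • g) ↔ (n : ℤ) ∣ r := by
  constructor
  · rintro ⟨g, hg⟩
    exact hG.dvd_of_nsmul_eq hn (h := g - h) (by rw [smul_sub, ← hg, e]; abel)
  · rintro ⟨s, rfl⟩
    exact ⟨h + s • o, by rw [e, mul_smul, natCast_zsmul, smul_add]⟩

theorem ResEq.dvd_iff {G H : Type*} [AddCommGroup G] [LinearOrder G] [IsOrderedAddMonoid G]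
    [AddCommGroup H] [LinearOrder H] [IsOrderedAddMonoid H] {o : G} {o' : H} (hG : IsZGroup o)
    (hH : IsZGroup o') {n : ℕ} (hn : 0 < n) {p : G × H} (h : ResEq o o' n p) :
    (∃ g, p.1 = n • g) ↔ ∃ g, p.2 = n • g := by
  obtain ⟨r, ⟨g, e⟩, ⟨k, f⟩⟩ := h
  rw [hG.exists_nsmul_eq_iff hn e, hH.exists_nsmul_eq_iff hn f]

variable [InterpCong M] [InterpCong N]

/-- Atomic formulas compare linear forms or their residues. For a quantifier, the depth leaves room
for one extension step, and swapping the two models supplies the other direction. -/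
theorem realize_iff_of_sim [Finite α] {n : ℕ} (φ : toagCong.BoundedFormula α n) {v : α → M}
    {w : α → N} {xs : Fin n → M} {ys : Fin n → N}
    (h : Sim (of 1) (of 1) (pairSet (Sum.elim v xs) (Sum.elim w ys)) (depth φ)) :
    φ.Realize v xs ↔ φ.Realize w ys := by
  induction φ with
  | falsum => rfl
  | equal s t =>
    have hs := pair_realize_mem_ball h s (Nat.le_add_right _ _)
    have ht := pair_realize_mem_ball h t (Nat.le_add_left _ _)
    have h1 := h.le_iff hs ht (by rw [depth]; omega)
    have h2 := h.le_iff ht hs (by rw [depth])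
    simp only [of_le_of] at h1 h2
    simp only [BoundedFormula.Realize]
    rw [le_antisymm_iff, h1, h2, ← le_antisymm_iff]
  | rel R ts =>
    have hts := fun i => pair_realize_mem_ball h (ts i)
      ((Finset.single_le_sum (f := fun i => cost (ts i)) (fun _ _ => Nat.zero_le _)
        (Finset.mem_univ i)).trans (Nat.le_add_left _ _))
    simp only [BoundedFormula.Realize]
    rcases R with R | R
    · refine (iff_of_eq (relMap_inl R _)).trans (Iff.trans ?_ (iff_of_eq (relMap_inl R _)).symm)
      cases R
      rw [Interp.le, Interp.le, ← of_le_of, ← of_le_of]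
      exact h.le_iff (hts 0) (hts 1) (by
        change _ ≤ _ + ∑ i, cost (ts i)
        rw [Fin.sum_univ_two]; omega)
    · rcases R with ⟨m, hm⟩
      refine (InterpCong.cong m hm _).trans (Iff.trans ?_ (InterpCong.cong m hm _).symm)
      exact ResEq.dvd_iff isZGroup isZGroup (by omega) (ResEq.of_mem_ball
        (fun p hp => h.res p hp m (by omega) (Nat.le_add_right _ _)) (sub_mem_ball (hts 0) (hts 1)))
  | imp φ ψ ih1 ih2 =>
    simp only [BoundedFormula.realize_imp]
    rw [ih1 (h.mono (le_max_left _ _)), ih2 (h.mono (le_max_right _ _))]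
  | all φ ih =>
    simp only [BoundedFormula.realize_all]
    constructor
    · intro H b
      have h' := h.swap
      rw [swap_image_pairSet] at h'
      obtain ⟨a, ha⟩ := exists_extension (depth_pos φ) h' b
      have ha' := ha.swap
      rw [swap_image_pairSet] at ha'
      exact (ih ha').1 (H a)
    · intro H a
      obtain ⟨b, hb⟩ := exists_extension (depth_pos φ) h a
      exact (ih hb).2 (H b)

end TOAG

namespace TOAG

open TruncGroup GroupExt

/-! ### Criteria for similarity -/

section Criteria

variable {β : Type*}

/-- The terms of depth at most `n` in the variables `β`. -/
def termSet (β : Type*) : ℕ → Set (toag.Term β)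
  | 0 => {0, 1, tau} ∪ Set.range Term.var
  | n + 1 => termSet β n ∪ (Set.image2 (· + ·) (termSet β n) (termSet β n) ∪
      Set.image2 monus (termSet β n) (termSet β n))

theorem finite_termSet [Finite β] (n : ℕ) : (termSet β n).Finite := by
  induction n with
  | zero => exact (Set.toFinite _).union (Set.finite_range _)
  | succ n ih => exact ih.union ((ih.image2 _ ih).union (ih.image2 _ ih))

theorem termSet_mono {m n : ℕ} (h : m ≤ n) : termSet β m ⊆ termSet β n := by
  induction h with
  | refl => exact le_rfl
  | step _ ih => exact ih.trans Set.subset_union_left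

theorem add_mem_termSet {n : ℕ} {s t : toag.Term β} (hs : s ∈ termSet β n) (ht : t ∈ termSet β n) :
    s + t ∈ termSet β (n + 1) := Or.inr (Or.inl ⟨s, hs, t, ht, rfl⟩)

theorem monus_mem_termSet {n : ℕ} {s t : toag.Term β} (hs : s ∈ termSet β n)
    (ht : t ∈ termSet β n) : s ∸ t ∈ termSet β (n + 1) := Or.inr (Or.inr ⟨s, hs, t, ht, rfl⟩)

theorem zero_mem_termSet (n : ℕ) : (0 : toag.Term β) ∈ termSet β n :=
  termSet_mono (Nat.zero_le n) (by simp [termSet])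

theorem tau_mem_termSet (n : ℕ) : (tau : toag.Term β) ∈ termSet β n :=
  termSet_mono (Nat.zero_le n) (by simp [termSet])

variable {M : Type u} {N : Type v} [TruncGroup M] [TruncGroup N] [toag.Structure M] [Interp M]
  [toag.Structure N] [Interp N] {a : β → M} {b : β → N}

theorem HasTop.top_eq : (HasTop.top : M) = topElt := rfl

theorem exists_term_of_mem_pairSet {p : GroupExt M × GroupExt N} (hp : p ∈ pairSet a b) :
    ∃ t ∈ termSet β 0, p = (of (t.realize a), of (t.realize b)) := by
  rcases hp with (rfl | rfl) | ⟨i, rfl⟩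
  · exact ⟨1, by simp [termSet], by simp⟩
  · exact ⟨tau, by simp [termSet], by simp [HasTop.top_eq]⟩
  · exact ⟨.var i, by simp [termSet], by simp⟩

/-- Every linear combination of the components is a multiple of `τ` plus the value of a term. -/
theorem exists_term_of_mem_ball {K : ℕ}
    (h : ∀ s ∈ termSet β (2 * K), ∀ t ∈ termSet β (2 * K),
      s.realize a ≤ t.realize a ↔ s.realize b ≤ t.realize b)
    {p : GroupExt M × GroupExt N} (hp : p ∈ ball (pairSet a b) K) :
    ∃ k : ℤ, ∃ s ∈ termSet β (2 * K), s.realize a < topElt ∧ s.realize b < topElt ∧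
      p = (k • of topElt + of (s.realize a), k • of topElt + of (s.realize b)) := by
  induction K generalizing p with
  | zero =>
    obtain rfl : p = 0 := hp
    refine ⟨0, 0, zero_mem_termSet _, ?_⟩
    simp only [realize_zero, of_zero, zero_smul, add_zero]
    exact ⟨top_pos, top_pos, rfl⟩
  | succ K ih =>
    obtain ⟨q, hq, e, he, rfl⟩ := hp
    -- Each further summand nests at most two more operations, as in s ∸ (τ ∸ t) and τ ∸ (t ∸ s);
    -- hence the depth 2K.
    have hsub := termSet_mono (β := β) (show 2 * K ≤ 2 * (K + 1) by omega)
    obtain ⟨k, s, hs, hsa, hsb, rfl⟩ :=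
      ih (fun s hs t ht => h s (hsub hs) t (hsub ht)) hq
    have hz : ∀ {t}, t ∈ termSet β 0 → t ∈ termSet β (2 * K) :=
      fun ht => termSet_mono (Nat.zero_le _) ht
    have h1 := termSet_mono (β := β) (show 2 * K + 1 ≤ 2 * (K + 1) by omega)
    have htop := tau_mem_termSet (β := β)
    rcases he with he | he | rfl
    · obtain ⟨t, ht, rfl⟩ := exists_term_of_mem_pairSet he
      have hst := h _ (htop _) _ (h1 (add_mem_termSet hs (hz ht)))
      simp only [realize_tau, realize_add, HasTop.top_eq] at hst
      rcases lt_or_ge (s.realize a + t.realize a) topElt with hc | hc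
      · have hc' := not_le.1 fun h' => hc.not_ge (hst.2 h')
        refine ⟨k, s + t, h1 (add_mem_termSet hs (hz ht)), ?_⟩
        simp only [realize_add]
        refine ⟨hc, hc', ?_⟩
        rw [of_add hc, of_add hc', Prod.mk_add_mk, add_assoc, add_assoc]
      · obtain ⟨h2, h3⟩ := of_sub_top_sub hsa hc
        obtain ⟨h4, h5⟩ := of_sub_top_sub hsb (hst.1 hc)
        refine ⟨k + 1, s ∸ (tau ∸ t), monus_mem_termSet (termSet_mono (Nat.le_succ _) hs)
          (monus_mem_termSet (htop _) (hz ht)), ?_⟩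
        simp only [realize_monus, realize_tau, HasTop.top_eq]
        refine ⟨h2, h4, ?_⟩
        rw [h3, h5, Prod.mk_add_mk, add_smul, add_smul, one_smul, one_smul]
        congr 1 <;> abel
    · obtain ⟨t, ht, hte⟩ := exists_term_of_mem_pairSet he
      obtain rfl : e = -(of (t.realize a), of (t.realize b)) := by rw [← hte, neg_neg]
      have hst := h _ (hsub (hz ht)) _ (hsub hs)
      rcases le_or_gt (t.realize a) (s.realize a) with hc | hc
      · refine ⟨k, s ∸ t, h1 (monus_mem_termSet hs (hz ht)), ?_⟩
        simp only [realize_monus]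
        refine ⟨sub_lt_top hc hsa, sub_lt_top (hst.1 hc) hsb, ?_⟩
        rw [of_sub hc, of_sub (hst.1 hc), Prod.neg_mk, Prod.mk_add_mk]
        congr 1 <;> abel
      -- A borrow: kτ + s - t = (k - 1)τ + (τ - (t - s)) when s < t.
      · have hc' := not_le.1 fun h' => hc.not_ge (hst.2 h')
        refine ⟨k - 1, tau ∸ (t ∸ s), monus_mem_termSet (htop _) (monus_mem_termSet (hz ht) hs), ?_⟩
        simp only [realize_monus, realize_tau, HasTop.top_eq]
        refine ⟨top_sub_lt (sub_pos_of_lt hc), top_sub_lt (sub_pos_of_lt hc'), ?_⟩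
        rw [of_top_sub, of_top_sub, of_sub hc.le, of_sub hc'.le, Prod.neg_mk, Prod.mk_add_mk,
          sub_smul, sub_smul, one_smul, one_smul]
        congr 1 <;> abel
    · exact ⟨k, s, hsub hs, hsa, hsb, add_zero _⟩

theorem GroupExt.zsmul_top_add_nonneg_iff {k : ℤ} {a : M} (ha : a < topElt) :
    0 ≤ k • of topElt + of a ↔ 0 ≤ k := by
  constructor
  · intro h
    by_contra hk
    have h1 : k • of (topElt : M) ≤ (-1 : ℤ) • of topElt :=
      zsmul_le_zsmul_left (of_nonneg _) (by omega)
    have h2 : of a < of topElt := (of_le_top a).lt_of_ne fun e => ha.ne (of_injective e)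
    have := add_lt_add_of_le_of_lt h1 h2
    rw [neg_smul, one_smul, neg_add_cancel] at this
    exact h.not_gt this
  · intro h
    exact add_nonneg (zsmul_nonneg (of_nonneg _) h) (of_nonneg _)

/-- Every form is kτ plus a term value below τ, with the same k in both models, and its sign is the
sign of k. -/
theorem sim_of_agree {K : ℕ}
    (h : ∀ s ∈ termSet β (2 * K), ∀ t ∈ termSet β (2 * K),
      s.realize a ≤ t.realize a ↔ s.realize b ≤ t.realize b)
    (htop : ∀ n, 0 < n → n ≤ K → ResEq (of 1) (of 1) n (of (topElt : M), of (topElt : N)))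
    (hres : ∀ i, ∀ n, 0 < n → n ≤ K → ResEq (of 1) (of 1) n (of (a i), of (b i))) :
    Sim (of 1) (of 1) (pairSet a b) K := by
  constructor
  · intro p hp
    obtain ⟨k, s, -, hsa, hsb, rfl⟩ := exists_term_of_mem_ball h hp
    exact (zsmul_top_add_nonneg_iff hsa).trans (zsmul_top_add_nonneg_iff hsb).symm
  · rintro _ ((rfl | rfl) | ⟨i, rfl⟩) n h0 hn
    · exact ⟨1, ⟨0, by simp⟩, ⟨0, by simp⟩⟩
    · exact htop n h0 hn
    · exact hres i n h0 hn

/-- From x ≥ 0 and r < n it follows that h ≥ 0, so r1 ≤ x ≤ τ. Hence m1 is not truncated for m ≤ r,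
whereas for larger m it might be, and the congruence would then speak about τ. -/
theorem congMod_nsmul_one_iff {n r : ℕ} (hr : r < n) {x : M} {h : GroupExt M}
    (e : of x = n • h + r • of 1) {m : ℕ} (hm : m ≤ r) : CongMod n x (m • 1) ↔ m = r := by
  have hle : r • of (1 : M) ≤ of topElt := by
    refine le_trans ?_ (of_le_top x)
    rw [e]
    refine le_add_of_nonneg_left (nsmul_nonneg ?_ n)
    by_contra hneg
    have h1 := isZGroup.le_of_pos (-h) (neg_pos.2 (not_le.1 hneg))
    have h2 : n • h ≤ -(n • of (1 : M)) := by
      rw [← smul_neg]; exact nsmul_le_nsmul_right (le_neg_of_le_neg h1) n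
    have h3 := nsmul_lt_nsmul_left (isZGroup (M := M)).pos hr
    have h4 : of x < 0 := by
      rw [e]
      exact (add_lt_add_of_le_of_lt h2 h3).trans_eq (neg_add_cancel _)
    exact (of_nonneg x).not_gt h4
  have hmle : m • of (1 : M) ≤ of topElt :=
    (nsmul_le_nsmul_left (isZGroup (M := M)).pos.le hm).trans hle
  rw [CongMod, of_nsmul_eq_min, min_eq_left hmle]
  constructor
  · rintro ⟨g, hg⟩
    have hd := (isZGroup (M := M)).dvd_of_nsmul_eq (n := n) (h := g - h) (r := (r : ℤ) - m) (by omega)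
      (by rw [smul_sub, ← hg, e, sub_smul, natCast_zsmul, natCast_zsmul]; abel)
    have := Int.eq_zero_of_dvd_of_nonneg_of_lt (by omega) (by omega) hd
    omega
  · rintro rfl
    exact ⟨h, by rw [e]; abel⟩

theorem resEq_of_congMod_iff {n : ℕ} (hn : 0 < n) {x : M} {y : N}
    (h : ∀ m < n, CongMod n x (m • 1) ↔ CongMod n y (m • 1)) :
    ResEq (of 1) (of 1) n (of x, of y) := by
  obtain ⟨g, r, hr, e⟩ := isZGroup.exists_rem hn (of x)
  obtain ⟨k, s, hs, f⟩ := isZGroup.exists_rem hn (of y)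
  have h1 := (h r hr).1 ((congMod_nsmul_one_iff hr e le_rfl).2 rfl)
  have h2 := (h s hs).2 ((congMod_nsmul_one_iff hs f le_rfl).2 rfl)
  -- Only the smaller of the two residues is tested, as its multiple of 1 is untruncated in both
  -- models.
  obtain rfl : r = s := by
    rcases le_total r s with h' | h'
    · exact (congMod_nsmul_one_iff hs f h').1 h1
    · exact ((congMod_nsmul_one_iff hr e h').1 h2).symm
  exact ⟨r, ⟨g, by rw [natCast_zsmul]; exact e⟩, ⟨k, by rw [natCast_zsmul]; exact f⟩⟩

end Criteria

/-! ### Model completeness -/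

section Toag

variable {M : Type u} {N : Type v} [TruncGroup M] [TruncGroup N] [toag.Structure M] [Interp M]
  [toag.Structure N] [Interp N] {α : Type*}

/-- The expansion by congruences. -/
@[reducible]
def congStructure (M : Type*) [TruncGroup M] [toag.Structure M] : toagCong.Structure M where
  funMap
    | .inl f => Structure.funMap (L := toag) f
    | .inr f => f.elim
  RelMap
    | .inl R => Structure.RelMap (L := toag) R
    | .inr (.cong n _) => fun v => CongMod n (v 0) (v 1)

theorem realize_iff_of_sim_toag [Finite α] {n : ℕ} (φ : toag.BoundedFormula α n) {v : α → M}
    {w : α → N} {xs : Fin n → M} {ys : Fin n → N}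
    (h : ∀ K, Sim (of 1) (of 1) (pairSet (Sum.elim v xs) (Sum.elim w ys)) K) :
    φ.Realize v xs ↔ φ.Realize w ys := by
  let _ := congStructure M
  let _ := congStructure N
  have : toagIncl.IsExpansionOn M := ⟨fun _ _ => rfl, fun _ _ => rfl⟩
  have : toagIncl.IsExpansionOn N := ⟨fun _ _ => rfl, fun _ _ => rfl⟩
  have : InterpCong M := ⟨fun _ _ _ => Iff.rfl⟩
  have : InterpCong N := ⟨fun _ _ _ => Iff.rfl⟩
  rw [← LHom.realize_onBoundedFormula toagIncl φ, ← LHom.realize_onBoundedFormula toagIncl φ]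
  exact realize_iff_of_sim _ (h _)

/-- For a < τ the equation a = n y + m1 is untruncated, and its image is the corresponding equation
for f a < τ. The residue of τ is reached through τ ∸ 1. -/
theorem resEq_embedding (f : M ↪[toag] N) {n : ℕ} (hn : 0 < n) (x : M) :
    ResEq (of 1) (of 1) n (of x, of (f x)) := by
  have hadd : ∀ a b : M, f (a + b) = f a + f b := fun a b => by
    have := f.map_fun (ToagFunc.add : toag.Functions 2) ![a, b]
    rw [Interp.add] at this
    exact this.trans (Interp.add _)
  have hsub : ∀ a b : M, f (a - b) = f a - f b := fun a b => by
    have := f.map_fun (ToagFunc.monus : toag.Functions 2) ![a, b]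
    rw [Interp.monus] at this
    exact this.trans (Interp.monus _)
  have hzero : f 0 = 0 := by
    have := f.map_fun (ToagFunc.zero : toag.Functions 0) ![]
    rw [Interp.zero] at this
    exact this.trans (Interp.zero _)
  have hone : f 1 = 1 := by
    have := f.map_fun (ToagFunc.one : toag.Functions 0) ![]
    rw [Interp.one] at this
    exact this.trans (Interp.one _)
  have htop : f topElt = topElt := by
    have := f.map_fun (ToagFunc.tau : toag.Functions 0) ![]
    rw [Interp.tau] at this
    exact this.trans (Interp.tau _)
  have hsmul : ∀ (k : ℕ) (a : M), f (k • a) = k • f a := fun k a => by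
    induction k with
    | zero => rw [zero_smul, zero_smul, hzero]
    | succ k ih => rw [succ_nsmul, succ_nsmul, hadd, ih]
  have key : ∀ a : M, a < topElt → ResEq (of 1) (of 1) n (of a, of (f a)) := by
    intro a ha
    obtain ⟨y, m, -, e⟩ := rem n hn a
    have hfa : f a < topElt := (le_top _).lt_of_ne fun h => ha.ne (f.injective (h.trans htop.symm))
    have e' : f a = n • f y + m • 1 := by rw [e, hadd, hsmul, hsmul, hone]
    refine ⟨m, ⟨of y, ?_⟩, ⟨of (f y), ?_⟩⟩
    · rw [e] at ha
      simp only [e]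
      rw [of_add ha, of_nsmul (lt_of_add_lt_left ha), of_nsmul (lt_of_add_lt_right ha),
        natCast_zsmul]
    · rw [e'] at hfa
      simp only [e']
      rw [of_add hfa, of_nsmul (lt_of_add_lt_left hfa), of_nsmul (lt_of_add_lt_right hfa),
        natCast_zsmul]
  rcases lt_or_eq_top x with h | rfl
  · exact key x h
  · have h1 : ResEq (of (1 : M)) (of (1 : N)) n (of 1, of 1) := ⟨1, ⟨0, by simp⟩, ⟨0, by simp⟩⟩
    have := (key (topElt - 1) (top_sub_lt zero_lt_unit)).add h1
    rw [hsub, hone, htop, of_top_sub, of_top_sub, Prod.mk_add_mk, sub_add_cancel,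
      sub_add_cancel] at this
    rwa [htop]

theorem sim_embedding (f : M ↪[toag] N) (a : α → M) (K : ℕ) :
    Sim (of 1) (of 1) (pairSet a (f ∘ a)) K := by
  refine sim_of_agree (fun s _ t _ => ?_) (fun n hn _ => ?_) fun i n hn _ =>
    resEq_embedding f hn (a i)
  · rw [HomClass.realize_term, HomClass.realize_term]
    have := f.map_rel (ToagRel.le : toag.Relations 2) ![s.realize a, t.realize a]
    rw [Interp.le] at this
    exact (this.trans (Interp.le _)).symm
  · have htop : f topElt = topElt := by
      have := f.map_fun (ToagFunc.tau : toag.Functions 0) ![]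
      rw [Interp.tau] at this
      exact this.trans (Interp.tau _)
    have := resEq_embedding f hn topElt
    rwa [htop] at this

end Toag

theorem isModelComplete_presTOAG : IsModelComplete.{u, v} presTOAG := by
  intro M N _ _ hM hN f
  obtain ⟨_, _⟩ := exists_truncGroup hM
  obtain ⟨_, _⟩ := exists_truncGroup hN
  refine ⟨⟨f, fun n φ a => ?_⟩, fun _ => rfl⟩
  refine (realize_iff_of_sim_toag φ fun K => ?_).symm
  have e : (Sum.elim (f ∘ a) default : Fin n ⊕ Fin 0 → N) = f ∘ Sum.elim a default := by
    funext i
    rcases i with i | i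
    · rfl
    · exact i.elim0
  have := sim_embedding f (Sum.elim a default : Fin n ⊕ Fin 0 → M) K
  rwa [← e] at this

end TOAG

namespace TOAG

open TruncGroup GroupExt

/-! ### Quantifier elimination -/

theorem isQF_iInf {L : FirstOrder.Language.{0, 0}} {α β : Type*} [Finite β] {n : ℕ}
    {f : β → L.BoundedFormula α n} (h : ∀ b, (f b).IsQF) : (BoundedFormula.iInf f).IsQF := by
  rw [BoundedFormula.iInf]
  generalize (@Finset.univ β (Fintype.ofFinite β)).toList = l
  induction l with
  | nil => exact BoundedFormula.isQF_bot.imp BoundedFormula.isQF_bot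
  | cons a l ih => exact (h a).inf ih

theorem isQF_iSup {L : FirstOrder.Language.{0, 0}} {α β : Type*} [Finite β] {n : ℕ}
    {f : β → L.BoundedFormula α n} (h : ∀ b, (f b).IsQF) : (BoundedFormula.iSup f).IsQF := by
  rw [BoundedFormula.iSup]
  generalize (@Finset.univ β (Fintype.ofFinite β)).toList = l
  induction l with
  | nil => exact BoundedFormula.isQF_bot
  | cons a l ih => exact (h a).sup ih

open Classical in
/-- A formula whose truth is determined by the truth of finitely many quantifier-free formulas is
equivalent to a quantifier-free formula. -/
theorem exists_isQF_of_finite {L : FirstOrder.Language.{0, 0}} {T : L.Theory} {n : ℕ}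
    (φ : L.Formula (Fin n)) {Δ : Set (L.Formula (Fin n))} (hΔ : Δ.Finite)
    (hqf : ∀ δ ∈ Δ, BoundedFormula.IsQF δ)
    (h : ∀ (M N : Theory.ModelType.{0, 0, 0} T) (v : Fin n → M) (w : Fin n → N),
      (∀ δ ∈ Δ, δ.Realize v ↔ δ.Realize w) → φ.Realize v → φ.Realize w) :
    ∃ ψ : L.Formula (Fin n), BoundedFormula.IsQF ψ ∧ T ⊨ᵇ BoundedFormula.iff φ ψ := by
  have : Finite Δ := hΔ
  let P : Set Δ → Prop := fun σ => ∃ (M : Theory.ModelType.{0, 0, 0} T) (v : Fin n → M),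
    φ.Realize v ∧ ∀ δ : Δ, δ ∈ σ ↔ δ.1.Realize v
  -- The disjunction of all Δ-types realized by some tuple satisfying φ; there are finitely many
  -- since Δ is finite.
  let ψ : L.Formula (Fin n) := BoundedFormula.iSup fun σ : {σ // P σ} =>
    BoundedFormula.iInf fun δ : Δ => if δ ∈ σ.1 then δ.1 else δ.1.not
  refine ⟨ψ, isQF_iSup fun σ => isQF_iInf fun δ => ?_, ?_⟩
  · split_ifs
    · exact hqf _ δ.2
    · exact (hqf _ δ.2).not
  · intro M v xs
    obtain rfl : xs = default := Subsingleton.elim _ _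
    rw [BoundedFormula.realize_iff, BoundedFormula.realize_iSup]
    constructor
    · intro hφ
      refine ⟨⟨{δ | δ.1.Realize v}, M, v, hφ, fun δ => Iff.rfl⟩, ?_⟩
      rw [BoundedFormula.realize_iInf]
      intro δ
      split_ifs with hδ
      · exact hδ
      · exact hδ
    · rintro ⟨⟨σ, M', v', hφ, hσ⟩, hM⟩
      rw [BoundedFormula.realize_iInf] at hM
      refine h M' M v' v (fun δ hδ => ?_) hφ
      have h1 := hM ⟨δ, hδ⟩
      rw [← hσ ⟨δ, hδ⟩]
      split_ifs at h1 with h2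
      · exact iff_of_true h2 h1
      · exact iff_of_false h2 h1

/-- The symbol `≤` of `toagCong`. -/
def leCong : toagCong.Relations 2 := Sum.inl ToagRel.le

theorem realize_leCong {M : Type*} [TruncGroup M] [toag.Structure M] [Interp M]
    [toagCong.Structure M] [toagIncl.IsExpansionOn M] {α : Type*} (s t : toag.Term α) (v : α → M) :
    (leCong.formula₂ (toagIncl.onTerm s) (toagIncl.onTerm t)).Realize v ↔
      s.realize v ≤ t.realize v := by
  rw [Formula.realize_rel₂]
  refine ((iff_of_eq (relMap_inl _ _)).trans (Interp.le _)).trans ?_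
  simp

theorem realize_congSymb {M : Type*} [TruncGroup M] [toag.Structure M] [Interp M]
    [toagCong.Structure M] [toagIncl.IsExpansionOn M] [InterpCong M] {α : Type*} {n : ℕ}
    (hn : 2 ≤ n) (s t : toag.Term α) (v : α → M) :
    ((congSymb n hn).formula₂ (toagIncl.onTerm s) (toagIncl.onTerm t)).Realize v ↔
      CongMod n (s.realize v) (t.realize v) := by
  rw [Formula.realize_rel₂, InterpCong.cong]
  simp

/-- The quantifier-free formulas that determine the similarity of tuples. -/
def atomicSet (α : Type*) (K : ℕ) : Set (toagCong.Formula α) :=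
  Set.image2 (fun s t => leCong.formula₂ (toagIncl.onTerm s) (toagIncl.onTerm t)) (termSet α (2 * K)) (termSet α (2 * K)) ∪
  ⋃ m : Finset.Icc 2 K, Set.image2 (fun t j =>
    (congSymb m.1 (Finset.mem_Icc.1 m.2).1).formula₂ (toagIncl.onTerm t) (toagIncl.onTerm (mult j 1)))
    (termSet α 0) (Set.Iio m.1)

theorem finite_atomicSet (α : Type*) [Finite α] (K : ℕ) : (atomicSet α K).Finite :=
  ((finite_termSet _).image2 _ (finite_termSet _)).union <|
    Set.finite_iUnion fun _ => (finite_termSet _).image2 _ (Set.finite_Iio _)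

theorem isQF_of_mem_atomicSet {α : Type*} {K : ℕ} {δ : toagCong.Formula α}
    (h : δ ∈ atomicSet α K) : BoundedFormula.IsQF δ := by
  rcases h with ⟨s, -, t, -, rfl⟩ | h
  · exact (BoundedFormula.IsAtomic.rel _ _).isQF
  · obtain ⟨m, s, -, t, -, rfl⟩ := Set.mem_iUnion.1 h
    exact (BoundedFormula.IsAtomic.rel _ _).isQF

theorem exists_interp_of_model {M : Type*} [toagCong.Structure M] (h : M ⊨ presTOAGCong) :
    ∃ (_ : toag.Structure M) (_ : TruncGroup M), Interp M ∧ InterpCong M ∧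
      toagIncl.IsExpansionOn M := by
  let _ := toagIncl.reduct M
  have hE : toagIncl.IsExpansionOn M := inferInstance
  rw [presTOAGCong, Theory.model_union_iff, LHom.onTheory_model] at h
  obtain ⟨_, hI⟩ := exists_truncGroup h.1
  refine ⟨inferInstance, inferInstance, hI, ⟨fun n hn v => ?_⟩, hE⟩
  have h1 : M ⊨ axCong n hn := h.2.realize_of_mem _ ⟨n, hn, rfl⟩
  have h2 : ∀ a b : M, Structure.RelMap (congSymb n hn) ![a, b] ↔ CongMod n a b := by
    intro a b
    have := h1 a b
    rw [BoundedFormula.realize_iff, LHom.realize_onBoundedFormula,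
      realize_congruent (by omega)] at this
    rw [BoundedFormula.realize_rel₂] at this
    simpa [Fin.snoc] using this
  have e : v = ![v 0, v 1] := by funext i; fin_cases i <;> rfl
  rw [e]
  exact h2 _ _

theorem hasQE_presTOAGCong : HasQE presTOAGCong := by
  intro n φ
  refine exists_isQF_of_finite φ (finite_atomicSet (Fin n) (depth φ))
    (fun _ => isQF_of_mem_atomicSet) fun M N v w h => ?_
  obtain ⟨_, _, _, _, _⟩ := exists_interp_of_model M.is_model
  obtain ⟨_, _, _, _, _⟩ := exists_interp_of_model N.is_model
  have hsub : pairSet (Sum.elim v default : Fin n ⊕ Fin 0 → M)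
      (Sum.elim w default : Fin n ⊕ Fin 0 → N) ⊆ pairSet v w := by
    rintro _ (hp | ⟨i | i, rfl⟩)
    · exact Or.inl hp
    · exact mem_pairSet v w i
    · exact i.elim0
  have hres : ∀ t ∈ termSet (Fin n) 0, ∀ m, 0 < m → m ≤ depth φ →
      ResEq (of 1) (of 1) m (of (t.realize v), of (t.realize w)) := by
    intro t ht m h0 hm
    refine resEq_of_congMod_iff h0 fun j hj => ?_
    -- There is no symbol for the modulus 1, where congruence is trivial.
    rcases Nat.eq_or_lt_of_le (Nat.succ_le_of_lt h0) with rfl | h2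
    · exact iff_of_true ⟨_, (one_smul _ _).symm⟩ ⟨_, (one_smul _ _).symm⟩
    have := h _ (Or.inr (Set.mem_iUnion.2
      ⟨⟨m, Finset.mem_Icc.2 ⟨h2, hm⟩⟩, t, ht, j, hj, rfl⟩))
    simp only [realize_congSymb] at this
    simpa [multiple_eq] using this
  refine (realize_iff_of_sim φ (Sim.subset (sim_of_agree ?_ ?_ ?_) hsub)).1
  · intro s hs t ht
    have := h _ (Or.inl ⟨s, hs, t, ht, rfl⟩)
    simpa only [realize_leCong] using this
  · intro m h0 hm
    simpa [HasTop.top_eq] using hres _ (tau_mem_termSet 0) m h0 hm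
  · intro i m h0 hm
    simpa using hres (.var i) (by simp [termSet]) m h0 hm

end TOAG

namespace TOAG

open TruncGroup GroupExt

/-! ### Finite models -/

/-- The truncated group `{0, …, n}`. -/
def FinModel (n : ℕ) : Type := {k : ℕ // k ≤ n}

namespace FinModel

variable {n : ℕ}

instance : LinearOrder (FinModel n) := inferInstanceAs (LinearOrder {k : ℕ // k ≤ n})
instance : Zero (FinModel n) := ⟨⟨0, Nat.zero_le n⟩⟩
-- The minimum is needed only to have an element for n = 0; the axioms are verified for n ≥ 1.
instance : One (FinModel n) := ⟨⟨min 1 n, min_le_right 1 n⟩⟩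
instance : HasTop (FinModel n) := ⟨⟨n, le_rfl⟩⟩
instance : Add (FinModel n) := ⟨fun a b => ⟨min (a.1 + b.1) n, min_le_right _ n⟩⟩
instance : Sub (FinModel n) := ⟨fun a b => ⟨a.1 - b.1, (Nat.sub_le _ _).trans a.2⟩⟩

instance : toag.Structure (FinModel n) where
  funMap
    | .zero, _ => 0
    | .one, _ => 1
    | .tau, _ => HasTop.top
    | .add, v => v 0 + v 1
    | .monus, v => v 0 - v 1
  RelMap
    | .le, v => v 0 ≤ v 1

instance : Interp (FinModel n) :=
  ⟨fun _ => rfl, fun _ => rfl, fun _ => rfl, fun _ => rfl, fun _ => rfl, fun _ => Iff.rfl⟩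

theorem val_zero : (0 : FinModel n).1 = 0 := rfl
theorem val_one : (1 : FinModel n).1 = min 1 n := rfl
theorem val_top : (HasTop.top : FinModel n).1 = n := rfl
theorem val_add (a b : FinModel n) : (a + b).1 = min (a.1 + b.1) n := rfl
theorem val_sub (a b : FinModel n) : (a - b).1 = a.1 - b.1 := rfl
theorem le_iff (a b : FinModel n) : a ≤ b ↔ a.1 ≤ b.1 := Iff.rfl
theorem lt_iff (a b : FinModel n) : a < b ↔ a.1 < b.1 := Iff.rfl
theorem eq_iff (a b : FinModel n) : a = b ↔ a.1 = b.1 := Subtype.ext_iff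

theorem val_multiple (k : ℕ) (a : FinModel n) : (multiple k a).1 = min (k * a.1) n := by
  induction k with
  | zero => simp [multiple, val_zero]
  | succ k ih =>
    have : (multiple (k + 1) a).1 = min ((multiple k a).1 + a.1) n := rfl
    rw [this, ih, Nat.succ_mul]
    omega

theorem presAxioms (hn : 1 ≤ n) : PresAxioms (FinModel n) := by
  have mem : ∀ a : FinModel n, a.1 ≤ n := fun a => a.2
  constructor <;>
    simp only [le_iff, lt_iff, eq_iff, val_zero, val_one, val_top, val_add, val_sub, val_multiple]
  case bounds => exact fun x => ⟨Nat.zero_le _, mem x⟩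
  case add_comm => intro x y; omega
  case add_zero_top => intro x; have := mem x; omega
  case add_le => intro x y z w; omega
  case add_assoc => intro x y z; omega
  case cancel => intro x y z; omega
  case diff =>
    intro x y h1 h2
    refine ⟨⟨y.1 - x.1, by omega⟩, ?_, fun z' => ?_⟩ <;> dsimp only <;> omega
  case add_sub => intro x y; omega
  case sub_zero => intro x y; omega
  case compl =>
    intro x hx
    have := mem x
    refine ⟨⟨n - x.1, by omega⟩, ?_, ?_⟩ <;> dsimp only <;> omega
  case compl_min =>
    intro x
    have := mem x
    exact ⟨by omega, fun z => by omega⟩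
  case compl_compl => intro x; have := mem x; omega
  case carry_comm => intro x y; omega
  case carry_assoc₁ => intro x y z; have := mem x; have := mem y; have := mem z; omega
  case carry_assoc₂ => intro x y z; have := mem x; have := mem y; have := mem z; omega
  case carry_lt => intro x y z; have := mem x; have := mem y; have := mem z; omega
  case carry_assoc₃ => intro x y z; have := mem x; have := mem y; have := mem z; omega
  case carry_top => intro x y z; have := mem x; have := mem y; have := mem z; omega
  case carry_assoc₄ => intro x y z; have := mem x; have := mem y; have := mem z; omega
  case one => exact ⟨by omega, fun x => by omega⟩
  case hasSucc =>
    intro x hx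
    refine ⟨⟨x.1 + 1, by omega⟩, ?_, fun z => ?_⟩ <;> dsimp only <;> omega
  case isSucc =>
    intro x hx
    have := mem x
    refine ⟨⟨x.1 - 1, by omega⟩, ?_, fun z => ?_⟩ <;> dsimp only <;> omega
  case rem =>
    intro k hk x
    have hx := mem x
    refine ⟨⟨x.1 / k, (Nat.div_le_self _ _).trans hx⟩, ⟨x.1 % k, Nat.mod_lt _ hk⟩, ?_⟩
    dsimp only
    rw [min_eq_left hn, mul_one]
    have := Nat.div_add_mod x.1 k
    omega

theorem model_presTOAG (hn : 1 ≤ n) : FinModel n ⊨ presTOAG :=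
  model_presTOAG_iff.2 (presAxioms hn)

instance : Nonempty (FinModel n) := ⟨0⟩

instance : Finite (FinModel n) := Set.finite_Iic n

theorem card_eq : Nat.card (FinModel n) = n + 1 := by
  have : Nat.card (FinModel n) = (Set.Iic n).ncard := rfl
  rw [this, Set.ncard_eq_toFinset_card']
  simp

theorem realize_tauEq_iff (hn : 1 ≤ n) {m : ℕ} (hm : 1 ≤ m) : FinModel n ⊨ tauEq m ↔ n = m := by
  have key : FinModel n ⊨ tauEq m ↔ multiple (m - 1) (1 : FinModel n) < HasTop.top ∧
      multiple m (1 : FinModel n) = HasTop.top := by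
    simp [tauEq, Sentence.Realize, Formula.Realize]
  rw [key]
  simp only [lt_iff, eq_iff, val_one, val_top, val_multiple, min_eq_left hn, mul_one]
  omega

end FinModel

/-! ### The group generated by an infinite or a finite model -/

section Models

variable {M : Type u} {N : Type v} [TruncGroup M] [TruncGroup N]

/-- If τ ≤ m1, discreteness makes every element of M one of 0, 1, …, m. -/
theorem nsmul_lt_top_of_infinite [Infinite M] (m : ℕ) : m • of (1 : M) < of topElt := by
  by_contra hc
  have key : ∀ a : M, ∃ j : Fin (m + 1), of a = j.1 • of 1 := fun a => by
    obtain ⟨j, hj, e⟩ := isZGroup.eq_zsmul_of_le m (of_nonneg a) ((of_le_top a).trans (not_lt.1 hc))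
    exact ⟨⟨j, by omega⟩, e⟩
  choose f hf using key
  exact not_injective_infinite_finite f fun a b h => of_injective (by rw [hf a, hf b, h])

/-- If τ exceeded all multiples of 1, these would be untruncated and pairwise distinct elements of
M. -/
theorem exists_top_eq_of_finite [Finite M] : ∃ n : ℕ, 1 ≤ n ∧ of (topElt : M) = n • of 1 := by
  by_cases h : ∃ m : ℕ, of (topElt : M) ≤ m • of 1
  · obtain ⟨m, hm⟩ := h
    obtain ⟨j, -, e⟩ := isZGroup.eq_zsmul_of_le m (of_nonneg _) hm
    refine ⟨j, ?_, e⟩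
    by_contra hj
    obtain rfl : j = 0 := by omega
    have := (isZGroup (M := M)).pos.trans_le (of_le_top (1 : M))
    rw [e, zero_smul] at this
    exact this.false
  · push Not at h
    refine absurd (fun a b hab => ?_) (not_injective_infinite_finite fun m : ℕ => m • (1 : M))
    have h' : of (a • (1 : M)) = of (b • (1 : M)) := congrArg of hab
    rw [of_nsmul_eq_min, of_nsmul_eq_min, min_eq_left (h a).le, min_eq_left (h b).le,
      ← natCast_zsmul, ← natCast_zsmul] at h'
    exact_mod_cast isZGroup.zsmul_inj h'

/-- As τ exceeds every integer multiple of 1, the order on the forms kτ + m1 is lexicographic and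
does not depend on the model. -/
theorem zsmul_add_nonneg_iff_of_infinite [Infinite M] (k m : ℤ) :
    0 ≤ k • of (topElt : M) + m • of 1 ↔ 0 < k ∨ k = 0 ∧ 0 ≤ m := by
  have hpos := (isZGroup (M := M)).pos
  have h1 : ∀ m : ℤ, m • of (1 : M) < of topElt := fun m =>
    (zsmul_le_zsmul_left hpos.le (Int.self_le_toNat m)).trans_lt
      (by rw [natCast_zsmul]; exact nsmul_lt_top_of_infinite _)
  rcases lt_trichotomy k 0 with h | rfl | h
  · refine iff_of_false (fun hc => ?_) (by omega)
    have h2 : k • of (topElt : M) ≤ (-1 : ℤ) • of topElt :=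
      zsmul_le_zsmul_left (of_nonneg _) (by omega)
    have := add_lt_add_of_le_of_lt h2 (h1 m)
    rw [neg_smul, one_smul, neg_add_cancel] at this
    exact hc.not_gt this
  · rw [zero_smul, zero_add, ← zero_smul ℤ (of (1 : M)), isZGroup.zsmul_le_zsmul_iff]
    simp
  · refine iff_of_true ?_ (Or.inl h)
    have h2 : (1 : ℤ) • of (topElt : M) ≤ k • of topElt :=
      zsmul_le_zsmul_left (of_nonneg _) (by omega)
    have h3 := h1 (-m)
    rw [one_smul] at h2
    rw [neg_smul, neg_lt_iff_pos_add] at h3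
    exact h3.le.trans (add_le_add_left h2 _)

/-- Without variables, the only linear forms are kτ + m1, so signs of these and residues of τ give
similarity at every level. -/
theorem sim_of_sign {X : Type*} [IsEmpty X] {a : X → M} {b : X → N}
    (hsign : ∀ k m : ℤ, 0 ≤ k • of (topElt : M) + m • of 1 ↔ 0 ≤ k • of (topElt : N) + m • of 1)
    (hres : ∀ n, 0 < n → ResEq (of 1) (of 1) n (of (topElt : M), of (topElt : N))) (K : ℕ) :
    Sim (of 1) (of 1) (pairSet a b) K := by
  constructor
  · intro p hp
    have : ∀ K, ∀ p ∈ ball (pairSet a b) K, ∃ k m : ℤ,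
        p = k • (of (topElt : M), of (topElt : N)) + m • (of 1, of 1) := by
      intro K
      induction K with
      | zero =>
        rintro p hp
        obtain rfl : p = 0 := hp
        exact ⟨0, 0, by simp⟩
      | succ K ih =>
        rintro _ ⟨q, hq, e, he, rfl⟩
        obtain ⟨k, m, rfl⟩ := ih q hq
        have hX : ∀ e ∈ pairSet a b, e = (of 1, of 1) ∨ e = (of (topElt : M), of (topElt : N)) := by
          rintro e ((rfl | rfl) | ⟨i, rfl⟩)
          · exact Or.inl rfl
          · exact Or.inr rfl
          · exact isEmptyElim i
        rcases he with he | he | rfl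
        · rcases hX e he with rfl | rfl
          · exact ⟨k, m + 1, by rw [add_smul m, one_smul]; abel⟩
          · exact ⟨k + 1, m, by rw [add_smul k, one_smul]; abel⟩
        · rcases hX _ he with he | he
          · exact ⟨k, m - 1, by rw [sub_smul m, one_smul, ← he]; abel⟩
          · exact ⟨k - 1, m, by rw [sub_smul k, one_smul, ← he]; abel⟩
        · exact ⟨k, m, by simp⟩
    obtain ⟨k, m, rfl⟩ := this K p hp
    exact hsign k m
  · rintro _ ((rfl | rfl) | ⟨i, rfl⟩) n h0 hn
    · exact ⟨1, ⟨0, by simp⟩, ⟨0, by simp⟩⟩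
    · exact hres n h0
    · exact isEmptyElim i

/-! ### Residues modulo products and residues of τ -/

/-- The Chinese remainder theorem with explicit witnesses: split x as (a u)x + (b v)x and insert in
each summand the expression for the other modulus. The resulting residue depends only on r and s, so
it is common to both models. -/
theorem eq_mul_nsmul_add {A : Type*} [AddCommGroup A] {a b : ℕ} {u v r s : ℤ}
    (huv : (a : ℤ) * u + b * v = 1) {x g k c : A} (h1 : x = a • g + r • c)
    (h2 : x = b • k + s • c) :
    x = (a * b) • (u • k + v • g) + (s * (a * u) + r * (b * v)) • c := by
  have e : x = ((a : ℤ) * u) • x + ((b : ℤ) * v) • x := by rw [← add_smul, huv, one_smul]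
  rw [e]
  nth_rw 1 [h2]
  nth_rw 1 [h1]
  simp only [← natCast_zsmul, smul_add, smul_smul, add_smul, Nat.cast_mul]
  rw [show (a : ℤ) * u * b = a * b * u by ring, show (b : ℤ) * v * a = a * b * v by ring,
    mul_comm s, mul_comm r]
  abel

theorem ResEq.mul_of_coprime {G H : Type*} [AddCommGroup G] [AddCommGroup H] {o : G} {o' : H}
    {a b : ℕ} (hab : Nat.Coprime a b) {p : G × H} (ha : ResEq o o' a p) (hb : ResEq o o' b p) :
    ResEq o o' (a * b) p := by
  obtain ⟨r, ⟨g, hg⟩, ⟨g', hg'⟩⟩ := ha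
  obtain ⟨s, ⟨k, hk⟩, ⟨k', hk'⟩⟩ := hb
  have huv : (a : ℤ) * Nat.gcdA a b + b * Nat.gcdB a b = 1 := by
    rw [← Nat.gcd_eq_gcd_ab, hab.gcd_eq_one, Nat.cast_one]
  exact ⟨_, ⟨_, eq_mul_nsmul_add huv hg hk⟩, ⟨_, eq_mul_nsmul_add huv hg' hk'⟩⟩

variable [toag.Structure M] [Interp M] [toag.Structure N] [Interp N]

theorem resEq_of_residueAxioms {f : ZHat} (hM : M ⊨ residueAxioms f) (hN : N ⊨ residueAxioms f)
    (n : ℕ) (hn : 0 < n) : ResEq (of 1) (of 1) n (of (topElt : M), of (topElt : N)) := by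
  induction n using Nat.recOnPosPrimePosCoprime with
  | prime_pow p k hp hk =>
    have h1 := hM.realize_of_mem _ ⟨⟨p, hp⟩, k, hk, rfl⟩
    have h2 := hN.realize_of_mem _ ⟨⟨p, hp⟩, k, hk, rfl⟩
    rw [realize_tauResidue (Nat.one_le_pow _ _ hp.pos)] at h1 h2
    obtain ⟨-, g, hg⟩ := h1
    obtain ⟨-, g', hg'⟩ := h2
    exact ⟨_, ⟨g, by rw [natCast_zsmul, ← hg, sub_add_cancel]⟩,
      ⟨g', by rw [natCast_zsmul, ← hg', sub_add_cancel]⟩⟩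
  | zero => exact absurd hn (lt_irrefl 0)
  | one => exact ⟨0, ⟨of topElt, by simp⟩, ⟨of topElt, by simp⟩⟩
  | coprime a b ha hb hab iha ihb =>
    exact ResEq.mul_of_coprime hab (iha (by omega)) (ihb (by omega))

theorem realize_tauResidue_of_top_eq {n : ℕ} (h : of (topElt : M) = n • of 1) {q : ℕ} (hq : 1 ≤ q)
    (m : ℕ) : M ⊨ tauResidue q m ↔ m ≤ n ∧ (q : ℤ) ∣ n - m := by
  have hZ := isZGroup (M := M)
  rw [realize_tauResidue hq, h, ← natCast_zsmul, ← natCast_zsmul, hZ.zsmul_le_zsmul_iff,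
    Nat.cast_le, ← sub_smul]
  refine and_congr_right fun _ => ⟨fun ⟨g, hg⟩ => hZ.dvd_of_nsmul_eq hq hg, fun ⟨c, hc⟩ => ?_⟩
  exact ⟨c • of 1, by rw [hc, mul_smul, natCast_zsmul]⟩

end Models

end TOAG

namespace TOAG

open TruncGroup GroupExt

/-! ### Completions -/

section Completions

theorem consequences_eq {L : FirstOrder.Language.{0, 0}} {T : L.Theory} (h : T.IsComplete)
    (M : Type*) [L.Structure M] [Nonempty M] (hM : M ⊨ T) : consequences T = L.completeTheory M :=
  h.eq_complete_theory M

theorem isMaximal_eq {L : FirstOrder.Language.{0, 0}} {T : L.Theory} (h : T.IsMaximal)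
    (M : Type*) [L.Structure M] [Nonempty M] (hM : M ⊨ T) : T = L.completeTheory M := by
  rw [← h.isComplete.eq_complete_theory M]
  ext φ
  exact h.mem_iff_models φ

theorem model_of_consequences_eq {L : FirstOrder.Language.{0, 0}} {T T' : L.Theory}
    (h : T.IsComplete) (e : consequences T = consequences T') {M : Type*} [L.Structure M]
    [Nonempty M] (hM : M ⊨ T) : M ⊨ T' := by
  refine ⟨fun φ hφ => ?_⟩
  have : φ ∈ consequences T := e ▸ Theory.models_sentence_of_mem hφ
  rwa [consequences_eq h M hM] at this

theorem consequences_mem_completions {L : FirstOrder.Language.{0, 0}} {T T' : L.Theory}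
    (h : T'.IsComplete) (hT : T ⊆ T') : consequences T' ∈ completions T := by
  obtain ⟨M⟩ := h.1
  refine ⟨fun φ hφ => Theory.models_sentence_of_mem (hT hφ), ?_⟩
  rw [consequences_eq h M M.is_model]
  exact completeTheory.isMaximal L M

/-- Sentences have no parameters, so any two models of T are similar at every level and therefore
elementarily equivalent. -/
theorem isComplete_of_sim {T : toag.Theory} (hsat : T.IsSatisfiable) (hT : presTOAG ⊆ T)
    (h : ∀ (M N : Type) [TruncGroup M] [TruncGroup N] [toag.Structure M] [toag.Structure N]
      [Interp M] [Interp N], M ⊨ T → N ⊨ T →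
      (∀ k m : ℤ, 0 ≤ k • of (topElt : M) + m • of 1 ↔ 0 ≤ k • of (topElt : N) + m • of 1) ∧
      ∀ n, 0 < n → ResEq (of 1) (of 1) n (of (topElt : M), of (topElt : N))) :
    T.IsComplete := by
  rw [Theory.IsComplete.isComplete_iff_models_elementarily_equivalent]
  refine ⟨hsat, fun M N => ?_⟩
  obtain ⟨_, _⟩ := exists_truncGroup (M.is_model.mono hT)
  obtain ⟨_, _⟩ := exists_truncGroup (N.is_model.mono hT)
  obtain ⟨h1, h2⟩ := h M N M.is_model N.is_model
  rw [elementarilyEquivalent_iff]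
  exact fun φ => realize_iff_of_sim_toag φ (sim_of_sign h1 h2)

/-! #### Infinite models -/

theorem exists_congruent (f : ZHat) (B : ℕ) : ∃ n : ℕ, 1 ≤ n ∧ B ≤ n ∧
    ∀ p : Nat.Primes, (p : ℕ) ≤ B → PadicInt.toZModPow B (f p) = n := by
  have hfin : {p : Nat.Primes | (p : ℕ) ≤ B}.Finite :=
    (Set.finite_Iic B).preimage Nat.Primes.coe_nat_injective.injOn
  let s : Nat.Primes → ℕ := fun p => (p : ℕ) ^ B
  have hs : ∀ p ∈ hfin.toFinset, s p ≠ 0 := fun p _ => pow_ne_zero _ p.2.ne_zero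
  obtain ⟨k, hk⟩ := Nat.chineseRemainderOfFinset
    (fun p : Nat.Primes => (PadicInt.toZModPow B (f p)).val) s hfin.toFinset hs
    (fun p _ q _ hpq => Nat.Coprime.pow _ _ ((Nat.coprime_primes p.2 q.2).2
      fun e => hpq (Subtype.ext e)))
  have hprod : 1 ≤ ∏ p ∈ hfin.toFinset, s p :=
    Nat.one_le_iff_ne_zero.2 (Finset.prod_ne_zero_iff.2 hs)
  -- Adding a multiple of the product makes n at least B and positive without changing its residues.
  refine ⟨k + (B + 1) * ∏ p ∈ hfin.toFinset, s p, ?_, ?_, fun p hp => ?_⟩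
  · nlinarith
  · nlinarith
  · have hmem : p ∈ hfin.toFinset := by simpa using hp
    have h1 := (ZMod.natCast_eq_natCast_iff _ _ _).2 (hk p hmem)
    have h2 : ((∏ p ∈ hfin.toFinset, s p : ℕ) : ZMod ((p : ℕ) ^ B)) = 0 :=
      (ZMod.natCast_eq_zero_iff _ _).2 (Finset.dvd_prod_of_mem s hmem)
    have : NeZero ((p : ℕ) ^ B) := ⟨hs p hmem⟩
    rw [Nat.cast_add, Nat.cast_mul, h2, mul_zero, add_zero, h1, ZMod.natCast_zmod_val]

/-- The theory whose models are the infinite models with residues `f`. -/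
noncomputable abbrev infTheory (f : ZHat) : toag.Theory :=
  presTOAG ∪ toag.infiniteTheory ∪ residueAxioms f

theorem isSatisfiable_infTheory (f : ZHat) : (infTheory f).IsSatisfiable := by
  -- Each axiom holds in {0, …, n} for all bounds from some B on, so that finitely many axioms can
  -- be treated with the largest of their bounds.
  have key : ∀ φ ∈ infTheory f, ∃ B : ℕ, ∀ B' n : ℕ, B ≤ B' → 1 ≤ n → B' ≤ n →
      (∀ p : Nat.Primes, (p : ℕ) ≤ B' → PadicInt.toZModPow B' (f p) = n) → FinModel n ⊨ φ := by
    rintro φ ((hφ | ⟨k, rfl⟩) | ⟨p, k, hk, rfl⟩)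
    · exact ⟨0, fun B' n _ hn _ _ => (FinModel.model_presTOAG hn).realize_of_mem _ hφ⟩
    · refine ⟨k, fun B' n hB hn hn' _ => ?_⟩
      rw [Sentence.realize_cardGe, ← Nat.cast_card, FinModel.card_eq, Nat.cast_le]
      omega
    -- The bound makes p and k small enough for the hypothesis on n to apply, and n at least p^k,
    -- hence above the residue, so that m1 is untruncated.
    · refine ⟨(p : ℕ) ^ k + k + p, fun B' n hB hn hn' hf => ?_⟩
      have hp0 : 0 < (p : ℕ) ^ k := pow_pos p.2.pos k
      have : NeZero ((p : ℕ) ^ k) := ⟨hp0.ne'⟩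
      let _ : TruncGroup (FinModel n) := (FinModel.presAxioms hn).truncGroup
      have hI : Interp (FinModel n) := inferInstance
      have htop : of (topElt : FinModel n) = n • of 1 :=
        realize_tauEq.1 ((FinModel.realize_tauEq_iff hn hn).2 rfl)
      rw [realize_tauResidue_of_top_eq htop hp0]
      have hval := ZMod.val_lt (PadicInt.toZModPow k (f p))
      refine ⟨by omega, ?_⟩
      have h1 : PadicInt.toZModPow k (f p) = n := by
        rw [← PadicInt.cast_toZModPow k B' (by omega), hf p (by omega)]
        exact ZMod.cast_natCast (pow_dvd_pow _ (by omega)) n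
      refine (ZMod.intCast_eq_intCast_iff_dvd_sub _ _ _).1 ?_
      rw [Int.cast_natCast, Int.cast_natCast, ZMod.natCast_zmod_val, h1]
  rw [Theory.isSatisfiable_iff_isFinitelySatisfiable]
  intro T₀ hT₀
  choose! B hB using key
  obtain ⟨n, hn, hBn, hf⟩ := exists_congruent f (T₀.sup B)
  have : FinModel n ⊨ (T₀ : toag.Theory) :=
    ⟨fun φ hφ => hB φ (hT₀ hφ) _ n (Finset.le_sup hφ) hn hBn hf⟩
  exact Theory.Model.isSatisfiable (FinModel n)

theorem infinite_of_model {f : ZHat} {M : Type*} [toag.Structure M] (h : M ⊨ infTheory f) :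
    Infinite M :=
  toag.model_infiniteTheory_iff.1 (h.mono fun _ hφ => Or.inl (Or.inr hφ))

theorem model_infTheory_iff {f : ZHat} {M : Type*} [toag.Structure M] :
    M ⊨ infTheory f ↔ M ⊨ presTOAG ∧ Infinite M ∧ M ⊨ residueAxioms f := by
  rw [Theory.model_union_iff, Theory.model_union_iff, model_infiniteTheory_iff, and_assoc]

theorem isComplete_of_infinite {T : toag.Theory} {f : ZHat} (hT : presTOAG ⊆ T)
    (hsub : T ⊆ infTheory f) (h : ∀ (M : Type) [toag.Structure M], M ⊨ T → M ⊨ infTheory f) :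
    T.IsComplete := by
  refine isComplete_of_sim ((isSatisfiable_infTheory f).mono hsub) hT
    fun M N _ _ _ _ _ _ hM hN => ⟨fun k m => ?_, fun n hn => ?_⟩
  · have := infinite_of_model (h M hM)
    have := infinite_of_model (h N hN)
    rw [zsmul_add_nonneg_iff_of_infinite, zsmul_add_nonneg_iff_of_infinite]
  · exact resEq_of_residueAxioms (model_infTheory_iff.1 (h M hM)).2.2
      (model_infTheory_iff.1 (h N hN)).2.2 n hn

theorem isComplete_infTheory (f : ZHat) : (infTheory f).IsComplete :=
  isComplete_of_infinite (fun _ h => Or.inl (Or.inl h)) le_rfl fun _ _ h => h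

/-- A finite model has τ = n, and its residue axioms say that f(p) ≡ n modulo every power of every
p. So f would be the positive integer n. -/
theorem isComplete_residueAxioms {f : ZHat} (hf : ¬ ∃ n : ℕ, 1 ≤ n ∧ ∀ p, f p = n) :
    (presTOAG ∪ residueAxioms f).IsComplete := by
  refine isComplete_of_infinite (f := f) (fun _ h => Or.inl h)
    (Set.union_subset_union_left _ Set.subset_union_left) fun M _ hM => ?_
  rw [Theory.model_union_iff] at hM
  refine model_infTheory_iff.2 ⟨hM.1, ?_, hM.2⟩
  by_contra hinf
  rw [not_infinite_iff_finite] at hinf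
  obtain ⟨_, _⟩ := exists_truncGroup hM.1
  obtain ⟨n, hn, e⟩ := exists_top_eq_of_finite (M := M)
  refine hf ⟨n, hn, fun p => PadicInt.ext_of_toZModPow.1 fun k => ?_⟩
  have hp0 : 0 < (p : ℕ) ^ k := pow_pos p.2.pos k
  have : NeZero ((p : ℕ) ^ k) := ⟨hp0.ne'⟩
  rcases Nat.eq_zero_or_pos k with rfl | hk
  · exact Subsingleton.elim (α := ZMod 1) _ _
  have h1 := hM.2.realize_of_mem _ ⟨p, k, hk, rfl⟩
  rw [realize_tauResidue_of_top_eq e hp0] at h1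
  have h2 := (ZMod.intCast_eq_intCast_iff_dvd_sub _ _ _).2 h1.2
  simpa using h2

theorem tauResidue_unique {M : Type*} [toag.Structure M] (hM : M ⊨ presTOAG) {q m m' : ℕ}
    (hm : m < q) (hm' : m' < q) (h : M ⊨ tauResidue q m) (h' : M ⊨ tauResidue q m') : m = m' := by
  obtain ⟨_, _⟩ := exists_truncGroup hM
  have hq : 0 < q := by omega
  rw [realize_tauResidue hq] at h h'
  obtain ⟨-, g, hg⟩ := h
  obtain ⟨-, g', hg'⟩ := h'
  have := (isZGroup (M := M)).dvd_of_nsmul_eq hq (h := g - g') (r := (m' : ℤ) - m) (by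
    rw [smul_sub, ← hg, ← hg', sub_smul, natCast_zsmul, natCast_zsmul]; abel)
  obtain ⟨c, hc⟩ := this
  -- Both residues lie in [0, q), so their difference q c has absolute value below q and c = 0.
  have h1 : c < 1 := by by_contra h; nlinarith
  have h2 : -1 < c := by by_contra h; nlinarith
  obtain rfl : c = 0 := by omega
  omega

/-- For fixed p, the residues of τ modulo the powers p^k are compatible by uniqueness and so define
a p-adic integer. In an infinite model every m1 lies below τ, which gives the remaining conjunct of
each axiom. -/
theorem exists_model_residueAxioms {M : Type*} [toag.Structure M] (hM : M ⊨ presTOAG)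
    [Infinite M] : ∃ f : ZHat, M ⊨ residueAxioms f := by
  obtain ⟨_, _⟩ := exists_truncGroup hM
  have hZ := isZGroup (M := M)
  have key : ∀ p : Nat.Primes, ∃ x : ℤ_[(p : ℕ)], ∀ k, ∃ h : GroupExt M,
      of (topElt : M) - (PadicInt.toZModPow k x).val • of 1 = ((p : ℕ) ^ k) • h := by
    intro p
    have h0 : ∀ k, 0 < (p : ℕ) ^ k := fun k => pow_pos p.2.pos k
    choose g r hr e using fun k => hZ.exists_rem (h0 k) (of (topElt : M))
    have hi : ∀ k, ((p : ℕ) : ℤ) ^ k ∣ (r (k + 1) : ℤ) - r k := fun k => by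
      have := hZ.dvd_of_nsmul_eq (h0 k) (h := g k - (p : ℕ) • g (k + 1))
        (r := (r (k + 1) : ℤ) - r k) (by
          rw [smul_sub, smul_smul, ← pow_succ, sub_smul, natCast_zsmul, natCast_zsmul,
            sub_eq_sub_iff_add_eq_add, add_comm _ (_ • g (k + 1)), ← e (k + 1), ← e k])
      exact_mod_cast this
    refine ⟨PadicInt.ofIntSeq _ (PadicInt.isCauSeq_padicNorm_of_pow_dvd_sub
      (fun k => (r k : ℤ)) p hi), fun k => ⟨g k, ?_⟩⟩
    rw [PadicInt.toZModPow_ofIntSeq_of_pow_dvd_sub (fun k => (r k : ℤ)) p hi, Int.cast_natCast,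
      ZMod.val_cast_of_lt (hr k), sub_eq_iff_eq_add]
    exact e k
  choose f hf using key
  refine ⟨f, ⟨?_⟩⟩
  rintro _ ⟨p, k, hk, rfl⟩
  rw [realize_tauResidue (pow_pos p.2.pos k)]
  exact ⟨(nsmul_lt_top_of_infinite _).le, hf p k⟩

/-- Injective because τ has only one residue modulo p^k in a common model. Surjective because a
maximal theory is the theory of any of its models, and an infinite model realizes some f. -/
theorem bijOn_infTheory : Set.BijOn (fun f : ZHat => consequences (infTheory f)) Set.univ
    {T ∈ completions presTOAG | toag.infiniteTheory ⊆ T} := by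
  refine ⟨fun f _ => ⟨consequences_mem_completions (isComplete_infTheory f)
    fun _ h => Or.inl (Or.inl h), fun φ hφ => Theory.models_sentence_of_mem (Or.inl (Or.inr hφ))⟩,
    fun f _ g _ e => ?_, ?_⟩
  · obtain ⟨M⟩ := (isComplete_infTheory f).1
    have hf := model_infTheory_iff.1 M.is_model
    have hg := model_infTheory_iff.1 (model_of_consequences_eq (isComplete_infTheory f) e M.is_model)
    funext p
    refine PadicInt.ext_of_toZModPow.1 fun k => ?_
    have hp0 : 0 < (p : ℕ) ^ k := pow_pos p.2.pos k
    have : NeZero ((p : ℕ) ^ k) := ⟨hp0.ne'⟩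
    rcases Nat.eq_zero_or_pos k with rfl | hk
    · exact Subsingleton.elim (α := ZMod 1) _ _
    exact ZMod.val_injective _ (tauResidue_unique hf.1 (ZMod.val_lt _) (ZMod.val_lt _)
      (hf.2.2.realize_of_mem _ ⟨p, k, hk, rfl⟩) (hg.2.2.realize_of_mem _ ⟨p, k, hk, rfl⟩))
  · rintro T ⟨⟨hT, hmax⟩, hinf⟩
    obtain ⟨M⟩ := hmax.1
    have hM := M.is_model.mono hT
    have : Infinite M := toag.model_infiniteTheory_iff.1 (M.is_model.mono hinf)
    obtain ⟨f, hf⟩ := exists_model_residueAxioms hM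
    refine ⟨f, Set.mem_univ _, ?_⟩
    rw [isMaximal_eq hmax M M.is_model]
    exact consequences_eq (isComplete_infTheory f) M (model_infTheory_iff.2 ⟨hM, this, hf⟩)

/-! #### Finite models -/

theorem model_tauEq_iff {n : ℕ} {M : Type*} [toag.Structure M] :
    M ⊨ presTOAG ∪ {tauEq n} ↔ M ⊨ presTOAG ∧ M ⊨ tauEq n := by
  rw [Theory.model_union_iff, Theory.model_singleton_iff]

theorem finModel_model_tauEq {n : ℕ} (hn : 1 ≤ n) : FinModel n ⊨ presTOAG ∪ {tauEq n} :=
  model_tauEq_iff.2 ⟨FinModel.model_presTOAG hn, (FinModel.realize_tauEq_iff hn hn).2 rfl⟩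

/-- Once τ = n1, the sign of kτ + m1 is that of the integer kn + m, and τ has residue n for every
modulus. -/
theorem isComplete_tauEq {n : ℕ} (hn : 1 ≤ n) : (presTOAG ∪ {tauEq n}).IsComplete := by
  have := finModel_model_tauEq hn
  refine isComplete_of_sim (Theory.Model.isSatisfiable (FinModel n)) Set.subset_union_left
    fun M N _ _ _ _ _ _ hM hN => ?_
  have h1 := realize_tauEq.1 (model_tauEq_iff.1 hM).2
  have h2 := realize_tauEq.1 (model_tauEq_iff.1 hN).2
  have e : ∀ {A : Type} [TruncGroup A] (k m : ℤ),
      0 ≤ k • n • of (1 : A) + m • of 1 ↔ 0 ≤ k * n + m := fun {A} _ k m => by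
    rw [← natCast_zsmul, smul_smul, ← add_smul, ← zero_smul ℤ (of (1 : A)),
      isZGroup.zsmul_le_zsmul_iff]
  refine ⟨fun k m => ?_, fun m hm => ⟨n, ⟨0, ?_⟩, ⟨0, ?_⟩⟩⟩
  · rw [h1, h2, e, e]
  · simp [h1]
  · simp [h2]

theorem bijOn_tauEq : Set.BijOn (fun n : ℕ => consequences (presTOAG ∪ {tauEq n})) {n | 1 ≤ n}
    {T ∈ completions presTOAG | ¬ toag.infiniteTheory ⊆ T} := by
  refine ⟨fun n hn => ⟨consequences_mem_completions (isComplete_tauEq hn) Set.subset_union_left,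
    fun h => ?_⟩, fun n hn m hm e => ?_, ?_⟩
  · have hM := finModel_model_tauEq hn
    have h' : toag.infiniteTheory ⊆ toag.completeTheory (FinModel n) :=
      (consequences_eq (isComplete_tauEq hn) (FinModel n) hM) ▸ h
    exact not_finite_iff_infinite.2 (toag.model_infiniteTheory_iff.1
      (Theory.model_iff_subset_completeTheory.2 h')) inferInstance
  · have := model_of_consequences_eq (isComplete_tauEq hn) e (finModel_model_tauEq hn)
    exact (FinModel.realize_tauEq_iff hn hm).1 (model_tauEq_iff.1 this).2
  · rintro T ⟨⟨hT, hmax⟩, hinf⟩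
    obtain ⟨M⟩ := hmax.1
    have hM := M.is_model.mono hT
    have hTM := isMaximal_eq hmax M M.is_model
    have hfin : Finite M := by
      rw [← not_infinite_iff_finite]
      intro h
      refine hinf ?_
      rw [hTM]
      exact Theory.model_iff_subset_completeTheory.1 (toag.model_infiniteTheory_iff.2 h)
    obtain ⟨_, _⟩ := exists_truncGroup hM
    obtain ⟨n, hn, e⟩ := exists_top_eq_of_finite (M := M)
    refine ⟨n, hn, ?_⟩
    rw [hTM]
    exact consequences_eq (isComplete_tauEq hn) M (model_tauEq_iff.2 ⟨hM, realize_tauEq.2 e⟩)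

/-! ### Consistency and incompleteness -/

theorem isSatisfiable_presTOAG : presTOAG.IsSatisfiable :=
  (isComplete_tauEq le_rfl).1.mono Set.subset_union_left

theorem not_isComplete_presTOAG : ¬ presTOAG.IsComplete := by
  intro h
  have h1 := FinModel.model_presTOAG (n := 1) le_rfl
  have h2 := FinModel.model_presTOAG (n := 2) one_le_two
  have := (h.realize_sentence_iff (tauEq 1) (FinModel 1)).trans
    (h.realize_sentence_iff (tauEq 1) (FinModel 2)).symm
  rw [FinModel.realize_tauEq_iff le_rfl le_rfl, FinModel.realize_tauEq_iff one_le_two le_rfl] at this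
  omega

end Completions

end TOAG

theorem mainTheorem12 :
    -- model completeness
    TOAG.IsModelComplete.{u, v} TOAG.presTOAG ∧
    -- consistent but not complete
    (TOAG.presTOAG.IsSatisfiable ∧ ¬ TOAG.presTOAG.IsComplete) ∧
    -- for `f` in the profinite integers, the axioms for infinite models together with
    -- `τ ≡ f(p) (mod p ^ k)` are complete
    (∀ f : TOAG.ZHat,
      (TOAG.presTOAG ∪ TOAG.toag.infiniteTheory ∪ TOAG.residueAxioms f).IsComplete) ∧
    -- and `f ↦` (this theory) is a bijection onto the completions with infinite models
    Set.BijOn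
      (fun f : TOAG.ZHat =>
        TOAG.consequences (TOAG.presTOAG ∪ TOAG.toag.infiniteTheory ∪ TOAG.residueAxioms f))
      Set.univ
      {T ∈ TOAG.completions TOAG.presTOAG | TOAG.toag.infiniteTheory ⊆ T} ∧
    -- unless `f` is a positive integer, the congruences alone are enough
    (∀ f : TOAG.ZHat, (¬ ∃ n : ℕ, 1 ≤ n ∧ ∀ p, f p = n) →
      (TOAG.presTOAG ∪ TOAG.residueAxioms f).IsComplete) ∧
    -- the remaining completions are given by `τ = n`, for `n` a positive integer
    (∀ n : ℕ, 1 ≤ n → (TOAG.presTOAG ∪ {TOAG.tauEq n}).IsComplete) ∧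
    Set.BijOn
      (fun n : ℕ => TOAG.consequences (TOAG.presTOAG ∪ {TOAG.tauEq n}))
      {n | 1 ≤ n}
      {T ∈ TOAG.completions TOAG.presTOAG | ¬ TOAG.toag.infiniteTheory ⊆ T} ∧
    -- quantifier elimination
    TOAG.HasQE TOAG.presTOAGCong :=
  ⟨TOAG.isModelComplete_presTOAG, ⟨TOAG.isSatisfiable_presTOAG, TOAG.not_isComplete_presTOAG⟩,
    TOAG.isComplete_infTheory, TOAG.bijOn_infTheory, fun _ => TOAG.isComplete_residueAxioms,
    fun _ => TOAG.isComplete_tauEq, TOAG.bijOn_tauEq, TOAG.hasQE_presTOAGCong⟩
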